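/- Let $\mathbb F$ be an algebraically closed field and let $q\in\mathbb F$ be nonzero and not a root of unity. Let $\triangle_q$ be the universal Askey--Wilson algebra, i.e. the unital associative $\mathbb F$-algebra with generators $A,B,C$ and relations saying that each of $$A+\frac{qBC-q^{-1}CB}{q^2-q^{-2}},\qquad B+\frac{qCA-q^{-1}AC}{q^2-q^{-2}},\qquad C+\frac{qAB-q^{-1}BA}{q^2-q^{-2}}$$ commutes with $A,B,C$. Let $\mathfrak H_q$ be the universal double affine Hecke algebra of type $(C_1^\vee,C_1)$, i.e. the unital associative $\mathbb F$-algebra with generators $t_i^{\pm1}$ ($i=0,1,2,3$) and relations $t_it_i^{-1}=t_i^{-1}t_i=1$, $t_i+t_i^{-1}$ is central ($i=0,1,2,3$), and $t_0t_1t_2t_3=q^{-1}$. Let $\zeta:\triangle_q\to\mathfrak H_q$ be the $\mathbb F$-algebra homomorphism with $$A\mapsto t_1t_0+(t_1t_0)^{-1},\qquad B\mapsto t_3t_0+(t_3t_0)^{-1},\qquad C\mapsto t_2t_0+(t_2t_0)^{-1};$$ every $\mathfrak H_q$-module is viewed as a $\triangle_q$-module by pulling back via $\zeta$. Let $V$ be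 a finite-dimensional irreducible $\mathfrak H_q$-module and, for $\theta\in\mathbb F$, let $V(\theta)=\{v\in V : t_0v=\theta v\}$, which is a $\triangle_q$-submodule of $V$. Then the following hold. (i) Suppose that $t_0$ is not diagonalizable on $V$. Then $t_0$ has a unique eigenvalue $\theta$ in $V$, and $\theta\in\{\pm1\}$. Moreover: (a) If $\dim V$ is even, then the $\triangle_q$-submodules of $V$ are exactly the members of the chain $\{0\}\subsetneq V(\theta)\subsetneq V$. (b) If $\dim V$ is odd, then $V(\theta)$ has a unique irreducible $\triangle_q$-submodule $V(\theta)'$ of codimension $1$ in $V(\theta)$, and the $\triangle_q$-submodules of $V$ are exactly the members of the chain $\{0\}\subsetneq V(\theta)'\subsetneq V(\theta)\subsetneq V$. (ii) Suppose that $t_0$ is diagonalizable on $V$. Then $t_0$ has at most two eigenvalues in $V$. Moreover: (a) If $t_0$ has exactly one eigenvalue in $V$, then the $\triangle_q$-module $V$ is irreducible and $\dim V\le 2$. (b) If $t_0$ has exactly two eigenvalues in $V$, then there is a nonzero scalar $\theta\in\mathbb F\setminus\{\pm1\}$ such that these eigenvalues are $\theta$ and $\theta^{-1}$, and the $\triangle_q$-submodules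 of $V$ are exactly $\{0\}$, $V(\theta)$, $V(\theta^{-1})$, $V$; both $V(\theta)$ and $V(\theta^{-1})$ are nonzero and proper, and $V=V(\theta)\oplus V(\theta^{-1})$, so the submodule lattice is a diamond. -/

import Mathlib

namespace AskeyWilson

/-! ### Identities behind the homomorphism from the Askey--Wilson algebra to the DAHA -/

section Identities

variable {K R : Type*} [CommRing K] [Ring R] [Algebra K R]

theorem three_relations (a b c a' b' c' : R) (c0 c1 c2 c3 q qi : K) (hq : q * qi = 1)
    (ha : a' = c0 • 1 - a) (hb : b' = c1 • 1 - b) (hc : c' = c2 • 1 - c)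
    (haa : a * a = c0 • a - 1) (hbb : b * b = c1 • b - 1) (hcc : c * c = c2 • c - 1)
    (h0 : q • (a * b * c) + qi • (c' * b' * a') = c3 • 1)
    (h1 : q • (b * c * a) + qi • (a' * c' * b') = c3 • 1)
    (h2 : q • (c * a * b) + qi • (b' * a' * c') = c3 • 1) :
    (q • ((q • (b * c) + qi • (c' * b')) * (c * a + a' * c'))
        - qi • ((c * a + a' * c') * (q • (b * c) + qi • (c' * b')))
        + (q ^ 2 - qi ^ 2) • (b * a + a' * b')
        = (q - qi) • ((c3 * c2) • 1 + c1 • (q • a' + qi • a))) ∧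
    (q • ((c * a + a' * c') * (b * a + a' * b'))
        - qi • ((b * a + a' * b') * (c * a + a' * c'))
        + (q ^ 2 - qi ^ 2) • (q • (b * c) + qi • (c' * b'))
        = (q - qi) • ((c2 * c1) • 1 + c3 • (q • a' + qi • a))) ∧
    (q • ((b * a + a' * b') * (q • (b * c) + qi • (c' * b')))
        - qi • ((q • (b * c) + qi • (c' * b')) * (b * a + a' * b'))
        + (q ^ 2 - qi ^ 2) • (c * a + a' * c')
        = (q - qi) • ((c1 * c3) • 1 + c2 • (q • a' + qi • a))) := by
  subst ha hb hc
  have haa' : ∀ x, a * (a * x) = c0 • (a * x) - x := fun x => by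
    rw [← mul_assoc, haa, sub_mul, smul_mul_assoc, one_mul]
  have hbb' : ∀ x, b * (b * x) = c1 • (b * x) - x := fun x => by
    rw [← mul_assoc, hbb, sub_mul, smul_mul_assoc, one_mul]
  have hcc' : ∀ x, c * (c * x) = c2 • (c * x) - x := fun x => by
    rw [← mul_assoc, hcc, sub_mul, smul_mul_assoc, one_mul]
  have e1 := congrArg (· * c) h1
  have e2 := congrArg ((c2 • 1 - c) * ·) h1
  have e3 := congrArg (· * (c2 • 1 - c)) h0
  have e4 := congrArg (c * ·) h0
  have f1 := congrArg (· * (c0 • 1 - a)) h1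
  have f2 := congrArg (· * a) h0
  have f3 := congrArg (· * a) h2
  have f4 := congrArg (a * ·) h2
  have g1 := congrArg (b * ·) h0
  have g2 := congrArg (· * (c1 • 1 - b)) h0
  have g3 := congrArg ((c1 • 1 - b) * ·) h1
  have g4 := congrArg (· * b) h1
  clear h0 h1
  simp only [mul_sub, sub_mul, mul_add, add_mul, smul_mul_assoc, mul_smul_comm, mul_one, one_mul,
    mul_assoc, haa, hbb, hcc, haa', hbb', hcc', smul_sub, smul_add, smul_smul] at *
  refine ⟨?_, ?_, ?_⟩
  · linear_combination (norm := skip) q • e1 - qi • e2 + q • e3 - qi • e4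
    clear * - hq
    match_scalars <;> grind
  · linear_combination (norm := skip) q ^ 2 • f1 - qi ^ 2 • f2 + f3 + f4 - c0 • h2
    clear * - hq
    match_scalars <;> grind
  · linear_combination (norm := skip) q • g1 - qi • g2 + q • g3 - qi • g4
    clear * - hq
    match_scalars <;> grind

end Identities

/-! ### The parameter, the algebras and the homomorphism between them -/

section Algebras

variable {F : Type*} [Field F]

/-- `q` is nonzero and not a root of unity. -/
structure IsGeneric (q : F) : Prop where
  ne_zero : q ≠ 0
  pow_ne_one : ∀ n : ℕ, 0 < n → q ^ n ≠ 1

/-- The element `x + (q y z - q⁻¹ z y) / (q² - q⁻²)` of an `F`-algebra. -/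
def awExpr (q : F) {R : Type*} [Ring R] [Algebra F R] (x y z : R) : R :=
  x + (q ^ 2 - q⁻¹ ^ 2)⁻¹ • (q • (y * z) - q⁻¹ • (z * y))

theorem map_awExpr (q : F) {R S : Type*} [Ring R] [Algebra F R] [Ring S] [Algebra F S]
    (f : R →ₐ[F] S) (x y z : R) : f (awExpr q x y z) = awExpr q (f x) (f y) (f z) := by
  simp [awExpr]

/-- Generators of the universal Askey--Wilson algebra. -/
inductive AWGen
  | A
  | B
  | C

open FreeAlgebra in
/-- Defining relations of the universal Askey--Wilson algebra: each of
`A + (qBC - q⁻¹CB)/(q² - q⁻²)`, `B + (qCA - q⁻¹AC)/(q² - q⁻²)`, `C + (qAB - q⁻¹BA)/(q² - q⁻²)`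
commutes with the generators. -/
inductive AWRel (q : F) : FreeAlgebra F AWGen → FreeAlgebra F AWGen → Prop
  | alpha (g : AWGen) :
      AWRel q (awExpr q (ι F AWGen.A) (ι F AWGen.B) (ι F AWGen.C) * ι F g)
        (ι F g * awExpr q (ι F AWGen.A) (ι F AWGen.B) (ι F AWGen.C))
  | beta (g : AWGen) :
      AWRel q (awExpr q (ι F AWGen.B) (ι F AWGen.C) (ι F AWGen.A) * ι F g)
        (ι F g * awExpr q (ι F AWGen.B) (ι F AWGen.C) (ι F AWGen.A))
  | gamma (g : AWGen) :
      AWRel q (awExpr q (ι F AWGen.C) (ι F AWGen.A) (ι F AWGen.B) * ι F g)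
        (ι F g * awExpr q (ι F AWGen.C) (ι F AWGen.A) (ι F AWGen.B))

/-- The universal Askey--Wilson algebra `△_q`. -/
abbrev AW (q : F) : Type _ := RingQuot (AWRel q)

/-- The class of a generator in `△_q`. -/
noncomputable def AW.gen (q : F) (g : AWGen) : AW q :=
  RingQuot.mkAlgHom F (AWRel q) (FreeAlgebra.ι F g)

/-- Generators `t i` and `tInv i` (`i = 0, 1, 2, 3`) of the universal DAHA. -/
inductive DAHAGen
  | t (i : Fin 4)
  | tInv (i : Fin 4)

open FreeAlgebra in
/-- Defining relations of the universal DAHA of type `(C₁^∨, C₁)`. -/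
inductive DAHARel (q : F) : FreeAlgebra F DAHAGen → FreeAlgebra F DAHAGen → Prop
  | mul_inv (i : Fin 4) : DAHARel q (ι F (DAHAGen.t i) * ι F (DAHAGen.tInv i)) 1
  | inv_mul (i : Fin 4) : DAHARel q (ι F (DAHAGen.tInv i) * ι F (DAHAGen.t i)) 1
  | central (i : Fin 4) (g : DAHAGen) :
      DAHARel q ((ι F (DAHAGen.t i) + ι F (DAHAGen.tInv i)) * ι F g)
        (ι F g * (ι F (DAHAGen.t i) + ι F (DAHAGen.tInv i)))
  | prod : DAHARel q
      (ι F (DAHAGen.t 0) * ι F (DAHAGen.t 1) * ι F (DAHAGen.t 2) * ι F (DAHAGen.t 3))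
      (algebraMap F _ q⁻¹)

/-- The universal DAHA `ℌ_q` of type `(C₁^∨, C₁)`. -/
abbrev DAHA (q : F) : Type _ := RingQuot (DAHARel q)

/-- The invertible element `t_i` of `ℌ_q`. -/
noncomputable def DAHA.t (q : F) (i : Fin 4) : (DAHA q)ˣ where
  val := RingQuot.mkAlgHom F (DAHARel q) (FreeAlgebra.ι F (DAHAGen.t i))
  inv := RingQuot.mkAlgHom F (DAHARel q) (FreeAlgebra.ι F (DAHAGen.tInv i))
  val_inv := by
    rw [← map_mul, RingQuot.mkAlgHom_rel F (DAHARel.mul_inv i), map_one]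
  inv_val := by
    rw [← map_mul, RingQuot.mkAlgHom_rel F (DAHARel.inv_mul i), map_one]

theorem DAHA.induction {q : F} {P : DAHA q → Prop}
    (hF : ∀ r : F, P (algebraMap F (DAHA q) r))
    (ht : ∀ i, P (DAHA.t q i)) (htInv : ∀ i, P ((DAHA.t q i)⁻¹ : (DAHA q)ˣ))
    (hadd : ∀ x y, P x → P y → P (x + y)) (hmul : ∀ x y, P x → P y → P (x * y))
    (x : DAHA q) : P x := by
  obtain ⟨x, rfl⟩ := RingQuot.mkAlgHom_surjective F (DAHARel q) x
  induction x using FreeAlgebra.induction with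
  | grade0 r => rw [AlgHom.commutes]; exact hF r
  | grade1 g =>
    cases g with
    | t i => exact ht i
    | tInv i => exact htInv i
  | mul x y hx hy => rw [map_mul]; exact hmul _ _ hx hy
  | add x y hx hy => rw [map_add]; exact hadd _ _ hx hy

theorem AW.induction {q : F} {P : AW q → Prop}
    (hF : ∀ r : F, P (algebraMap F (AW q) r)) (hg : ∀ g, P (AW.gen q g))
    (hadd : ∀ x y, P x → P y → P (x + y)) (hmul : ∀ x y, P x → P y → P (x * y))
    (x : AW q) : P x := by
  obtain ⟨x, rfl⟩ := RingQuot.mkAlgHom_surjective F (AWRel q) x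
  induction x using FreeAlgebra.induction with
  | grade0 r => rw [AlgHom.commutes]; exact hF r
  | grade1 g => exact hg g
  | mul x y hx hy => rw [map_mul]; exact hmul _ _ hx hy
  | add x y hx hy => rw [map_add]; exact hadd _ _ hx hy

theorem DAHA.central (q : F) (i : Fin 4) (x : DAHA q) :
    Commute ((DAHA.t q i : DAHA q) + ((DAHA.t q i)⁻¹ : (DAHA q)ˣ)) x := by
  have key : ∀ g : DAHAGen,
      Commute ((DAHA.t q i : DAHA q) + ((DAHA.t q i)⁻¹ : (DAHA q)ˣ))
        (RingQuot.mkAlgHom F (DAHARel q) (FreeAlgebra.ι F g)) := fun g => by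
    have h := RingQuot.mkAlgHom_rel F (DAHARel.central (q := q) i g)
    simp only [map_mul, map_add] at h
    exact h
  induction x using DAHA.induction with
  | hF r => exact (Algebra.commutes r _).symm
  | ht j => exact key (DAHAGen.t j)
  | htInv j => exact key (DAHAGen.tInv j)
  | hadd x y hx hy => exact hx.add_right hy
  | hmul x y hx hy => exact hx.mul_right hy

theorem DAHA.prod (q : F) :
    (DAHA.t q 0 : DAHA q) * DAHA.t q 1 * DAHA.t q 2 * DAHA.t q 3 = algebraMap F _ q⁻¹ := by
  have h := RingQuot.mkAlgHom_rel F (DAHARel.prod (q := q))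
  simp only [map_mul, AlgHom.commutes] at h
  exact h

/-- `t_i t_0 + (t_i t_0)⁻¹`. -/
noncomputable def DAHA.sym (q : F) (i : Fin 4) : DAHA q :=
  ((DAHA.t q i * DAHA.t q 0 : (DAHA q)ˣ) : DAHA q) +
    ((DAHA.t q i * DAHA.t q 0)⁻¹ : (DAHA q)ˣ)

theorem DAHA.t_zero_commute_sym (q : F) (i : Fin 4) :
    Commute (DAHA.t q 0 : DAHA q) (DAHA.sym q i) := by
  have h0 := fun x => (DAHA.central q 0 x).eq
  have h1 := fun x => (DAHA.central q i x).eq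
  simp only [DAHA.sym, mul_inv_rev, Units.val_mul]
  generalize hb : DAHA.t q i = b at *
  generalize ha : DAHA.t q 0 = a at *
  have k1 := h1 a
  have k2 := h0 b
  have e : (b : DAHA q) * a + (a⁻¹ : (DAHA q)ˣ) * (b⁻¹ : (DAHA q)ˣ)
      = a * b + (b⁻¹ : (DAHA q)ˣ) * (a⁻¹ : (DAHA q)ˣ) := by
    have k3 := h0 (b⁻¹ : (DAHA q)ˣ)
    simp only [add_mul, mul_add] at k1 k2 k3
    linear_combination (norm := abel) k3 + k1
  have e' := congrArg ((a : DAHA q) * ·) e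
  have e'' : (a : DAHA q) * (b * a + (a⁻¹ : (DAHA q)ˣ) * (b⁻¹ : (DAHA q)ˣ))
     = (a * b + (b⁻¹ : (DAHA q)ˣ) * (a⁻¹ : (DAHA q)ˣ)) * a := by
    simp [mul_add, add_mul, mul_assoc]
  show _ = _
  rw [e'', e]

theorem DAHA.t_three (q : F) (hq : q ≠ 0) :
    (DAHA.t q 3 : DAHA q) = q⁻¹ • (((DAHA.t q 2)⁻¹ : (DAHA q)ˣ) *
      ((DAHA.t q 1)⁻¹ : (DAHA q)ˣ) * ((DAHA.t q 0)⁻¹ : (DAHA q)ˣ)) ∧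
    (((DAHA.t q 3)⁻¹ : (DAHA q)ˣ) : DAHA q) =
      q • ((DAHA.t q 0 : DAHA q) * DAHA.t q 1 * DAHA.t q 2) := by
  have h := DAHA.prod q
  generalize DAHA.t q 0 = a at *
  generalize DAHA.t q 1 = b at *
  generalize DAHA.t q 2 = c at *
  generalize DAHA.t q 3 = d at *
  rw [Algebra.algebraMap_eq_smul_one] at h
  constructor
  · have h' := congrArg
      (((c⁻¹ : (DAHA q)ˣ) * (b⁻¹ : (DAHA q)ˣ) * (a⁻¹ : (DAHA q)ˣ) : DAHA q) * ·) h
    simpa [mul_assoc] using h'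
  · have h' := congrArg (fun x => q • (x * ((d⁻¹ : (DAHA q)ˣ) : DAHA q))) h
    simp only [smul_mul_assoc, one_mul, smul_smul, mul_inv_cancel₀ hq, one_smul,
      Units.mul_inv_cancel_right] at h'
    exact h'.symm

/-- In any `F`-algebra with units satisfying the relations of `ℌ_q`, the images of `α/(q+q⁻¹)`,
`β/(q+q⁻¹)`, `γ/(q+q⁻¹)` are combinations of `1` and `t₀` with central coefficients. -/
theorem awExpr_combination {q : F} (hq : IsGeneric q) {R : Type*} [Ring R] [Algebra F R]
    (t : Fin 4 → Rˣ) (hcen : ∀ i x, Commute ((t i : R) + ((t i)⁻¹ : Rˣ)) x)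
    (d1 : (t 3 : R) = q⁻¹ • (((t 2)⁻¹ : Rˣ) * ((t 1)⁻¹ : Rˣ) * ((t 0)⁻¹ : Rˣ)))
    (d2 : (((t 3)⁻¹ : Rˣ) : R) = q • ((t 0 : R) * t 1 * t 2)) (y : Fin 4 → R)
    (hy : ∀ i, y i = (t i : R) * t 0 + ((t 0)⁻¹ : Rˣ) * ((t i)⁻¹ : Rˣ)) :
    ∃ z w : Fin 3 → Subring.center R,
      awExpr q (y 1) (y 3) (y 2) = z 0 • (1 : R) + w 0 • (t 0 : R) ∧
      awExpr q (y 3) (y 2) (y 1) = z 1 • (1 : R) + w 1 • (t 0 : R) ∧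
      awExpr q (y 2) (y 1) (y 3) = z 2 • (1 : R) + w 2 • (t 0 : R) := by
  have hq0 := hq.ne_zero
  obtain ⟨s, hs⟩ : ∃ s : Fin 4 → Subring.center R,
      ∀ i, s i • (1 : R) = (t i : R) + ((t i)⁻¹ : Rˣ) :=
    ⟨fun i => ⟨(t i : R) + ((t i)⁻¹ : Rˣ), by
      rw [Subring.mem_center_iff]
      exact fun x => ((hcen i x).eq).symm⟩, fun i => by
        rw [Subring.smul_def, smul_eq_mul, mul_one]⟩
  have hinv : ∀ i, (((t i)⁻¹ : Rˣ) : R) = s i • (1 : R) - t i :=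
    fun i => by rw [hs, add_sub_cancel_left]
  have hsq : ∀ i, (t i : R) * t i = s i • (t i : R) - 1 := fun i => by
    have : s i • (t i : R) = (s i • (1 : R)) * t i := by rw [smul_mul_assoc, one_mul]
    rw [this, hs, add_mul, Units.inv_mul, add_sub_cancel_right]
  obtain ⟨φ, hφ⟩ : ∃ φ : F →+* Subring.center R, ∀ (r : F) (x : R), φ r • x = r • x :=
    ⟨(algebraMap F R).codRestrict (Subring.center R) (fun r => by
      rw [Subring.mem_center_iff]
      exact fun x => (Algebra.commutes r x).symm), fun r x => by
        rw [Subring.smul_def, Algebra.smul_def]; rfl⟩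
  have hQ : φ q * φ q⁻¹ = 1 := by rw [← map_mul, mul_inv_cancel₀ hq0, map_one]
  have h0 : φ q • ((t 0 : R) * t 1 * t 2) +
      φ q⁻¹ • (((t 2)⁻¹ : Rˣ) * ((t 1)⁻¹ : Rˣ) * ((t 0)⁻¹ : Rˣ) : R) = s 3 • (1 : R) := by
    rw [hφ, hφ, hs, d1, d2, add_comm]
  have conj : ∀ (u : Rˣ) (x : R), x = s 3 • (1 : R) →
      (u⁻¹ : Rˣ) * x * u = s 3 • (1 : R) := fun u x hx => by
    rw [hx, mul_smul_comm, smul_mul_assoc, mul_one, Units.inv_mul]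
  have h1 := conj (t 0) _ h0
  simp only [mul_add, add_mul, mul_smul_comm, smul_mul_assoc, mul_assoc, Units.inv_mul,
    Units.inv_mul_cancel_left, mul_one] at h1
  have h2 := conj (t 1) _ h1
  simp only [mul_add, add_mul, mul_smul_comm, smul_mul_assoc, mul_assoc, Units.inv_mul,
    Units.inv_mul_cancel_left, mul_one] at h2
  have r := three_relations (K := Subring.center R) _ _ _ _ _ _ (s 0) (s 1) (s 2) (s 3)
    (φ q) (φ q⁻¹) hQ (hinv 0) (hinv 1) (hinv 2) (hsq 0) (hsq 1) (hsq 2) h0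
    (by simpa only [mul_assoc] using h1) (by simpa only [mul_assoc] using h2)
  have e3 : y 3 = φ q • ((t 1 : R) * t 2) +
      φ q⁻¹ • (((t 2)⁻¹ : Rˣ) * ((t 1)⁻¹ : Rˣ) : R) := by
    rw [hy, d1, d2, hφ, hφ, add_comm]
    simp only [mul_smul_comm, smul_mul_assoc, mul_assoc, Units.inv_mul,
      Units.inv_mul_cancel_left, mul_one]
  rw [← hy 1, ← hy 2, ← e3] at r
  have hne : q ^ 2 - q⁻¹ ^ 2 ≠ 0 := fun h => by
    apply hq.pow_ne_one 4 (by norm_num)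
    field_simp at h
    linear_combination h
  have fin : ∀ (x y z : R) (u v : Subring.center R),
      φ q • (y * z) - φ q⁻¹ • (z * y) + (φ q ^ 2 - φ q⁻¹ ^ 2) • x =
        (φ q - φ q⁻¹) • (u • (1 : R) + v • (φ q • (((t 0)⁻¹ : Rˣ) : R) +
          φ q⁻¹ • (t 0 : R))) →
      ∃ z₁ z₂ : Subring.center R, awExpr q x y z = z₁ • (1 : R) + z₂ • (t 0 : R) := by
    intro x y z u v hx
    have hx' : awExpr q x y z = φ (q ^ 2 - q⁻¹ ^ 2)⁻¹ • ((φ q - φ q⁻¹) • (u • (1 : R) +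
        v • (φ q • (((t 0)⁻¹ : Rˣ) : R) + φ q⁻¹ • (t 0 : R)))) := by
      rw [← hx, ← map_pow, ← map_pow, ← map_sub, hφ, hφ, hφ, hφ, smul_add, inv_smul_smul₀ hne,
        awExpr, add_comm]
    rw [hinv] at hx'
    refine ⟨φ (q ^ 2 - q⁻¹ ^ 2)⁻¹ * (φ q - φ q⁻¹) * (u + v * φ q * s 0),
      φ (q ^ 2 - q⁻¹ ^ 2)⁻¹ * (φ q - φ q⁻¹) * v * (φ q⁻¹ - φ q), ?_⟩
    rw [hx']
    module
  obtain ⟨z0, w0, k0⟩ := fin _ _ _ _ _ r.1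
  obtain ⟨z1, w1, k1⟩ := fin _ _ _ _ _ r.2.1
  obtain ⟨z2, w2, k2⟩ := fin _ _ _ _ _ r.2.2
  exact ⟨![z0, z1, z2], ![w0, w1, w2], k0, k1, k2⟩

/-- Images of the generators of `△_q` in `ℌ_q`. -/
noncomputable def zetaGen (q : F) : AWGen → DAHA q
  | AWGen.A => ((DAHA.t q 1 * DAHA.t q 0 : (DAHA q)ˣ) : DAHA q) +
      ((DAHA.t q 1 * DAHA.t q 0)⁻¹ : (DAHA q)ˣ)
  | AWGen.B => ((DAHA.t q 3 * DAHA.t q 0 : (DAHA q)ˣ) : DAHA q) +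
      ((DAHA.t q 3 * DAHA.t q 0)⁻¹ : (DAHA q)ˣ)
  | AWGen.C => ((DAHA.t q 2 * DAHA.t q 0 : (DAHA q)ˣ) : DAHA q) +
      ((DAHA.t q 2 * DAHA.t q 0)⁻¹ : (DAHA q)ˣ)

theorem t_zero_commute_zetaGen (q : F) (g : AWGen) :
    Commute (DAHA.t q 0 : DAHA q) (zetaGen q g) := by
  cases g <;> exact DAHA.t_zero_commute_sym q _

theorem zetaGen_rel {q : F} (hq : IsGeneric q) (x y : FreeAlgebra F AWGen) (h : AWRel q x y) :
    FreeAlgebra.lift F (zetaGen q) x = FreeAlgebra.lift F (zetaGen q) y := by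
  obtain ⟨z, w, e0, e1, e2⟩ := awExpr_combination hq (DAHA.t q) (DAHA.central q)
    (DAHA.t_three q hq.ne_zero).1 (DAHA.t_three q hq.ne_zero).2 (DAHA.sym q)
    (fun i => by simp only [DAHA.sym, mul_inv_rev, Units.val_mul])
  have key : ∀ (x : DAHA q) (u v : Subring.center (DAHA q)) (g : AWGen),
      x = u • (1 : DAHA q) + v • (DAHA.t q 0 : DAHA q) → x * zetaGen q g = zetaGen q g * x := by
    intro x u v g e
    rw [e, add_mul, mul_add, smul_mul_assoc, smul_mul_assoc, mul_smul_comm, mul_smul_comm,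
      one_mul, mul_one, (t_zero_commute_zetaGen q g).eq]
  cases h with
  | alpha g =>
    simp only [map_mul, map_awExpr, FreeAlgebra.lift_ι_apply]
    exact key _ _ _ g e0
  | beta g =>
    simp only [map_mul, map_awExpr, FreeAlgebra.lift_ι_apply]
    exact key _ _ _ g e1
  | gamma g =>
    simp only [map_mul, map_awExpr, FreeAlgebra.lift_ι_apply]
    exact key _ _ _ g e2

/-- The homomorphism `ζ : △_q → ℌ_q` with `A ↦ t₁t₀ + (t₁t₀)⁻¹`, `B ↦ t₃t₀ + (t₃t₀)⁻¹`,
`C ↦ t₂t₀ + (t₂t₀)⁻¹`. -/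
noncomputable def zeta {q : F} (hq : IsGeneric q) : AW q →ₐ[F] DAHA q :=
  RingQuot.liftAlgHom F ⟨FreeAlgebra.lift F (zetaGen q), zetaGen_rel hq⟩

theorem zeta_gen {q : F} (hq : IsGeneric q) (g : AWGen) :
    zeta hq (AW.gen q g) = zetaGen q g := by
  simp [zeta, AW.gen]

theorem t_zero_commute_zeta {q : F} (hq : IsGeneric q) (x : AW q) :
    Commute (DAHA.t q 0 : DAHA q) (zeta hq x) := by
  induction x using AW.induction with
  | hF r => rw [AlgHom.commutes]; exact (Algebra.commutes r _).symm
  | hg g => rw [zeta_gen]; exact t_zero_commute_zetaGen q g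
  | hadd x y hx hy => rw [map_add]; exact hx.add_right hy
  | hmul x y hx hy => rw [map_mul]; exact hx.mul_right hy

end Algebras

/-! ### `ℌ_q`-modules as `△_q`-modules -/

section Modules

variable {F : Type*} [Field F] {q : F}

/-- The `ℌ_q`-module `V` viewed as a `△_q`-module by pulling back via `ζ`. -/
def Pullback (_hq : IsGeneric q) (V : Type*) : Type _ := V

variable (hq : IsGeneric q) (V : Type*) [AddCommGroup V] [Module F V] [Module (DAHA q) V]

instance : AddCommGroup (Pullback hq V) := inferInstanceAs (AddCommGroup V)

instance : Module F (Pullback hq V) := inferInstanceAs (Module F V)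

noncomputable instance : Module (AW q) (Pullback hq V) :=
  Module.compHom V (zeta hq : AW q →+* DAHA q)

/-- The identity map from `V` to its pullback. -/
def Pullback.of : V ≃ₗ[F] Pullback hq V := LinearEquiv.refl F V

variable {V}

theorem Pullback.smul_of (x : AW q) (v : V) :
    x • Pullback.of hq V v = Pullback.of hq V (zeta hq x • v) := rfl

variable [IsScalarTower F (DAHA q) V]

instance : IsScalarTower F (AW q) (Pullback hq V) where
  smul_assoc r x v := by
    obtain ⟨v, rfl⟩ := (Pullback.of hq V).surjective v
    rw [Pullback.smul_of, Pullback.smul_of, AlgHom.map_smul_of_tower, smul_assoc,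
      LinearEquiv.map_smul]

variable (q V) in
/-- The action of `t₀` on the `ℌ_q`-module `V`. -/
noncomputable def t0End : Module.End F V :=
  Algebra.lsmul F F V (DAHA.t q 0 : DAHA q)

variable (V) in
/-- The null space `V(θ)` of `t₀ - θ` in `V`, as a `△_q`-submodule. -/
noncomputable def t0Eigenspace (θ : F) : Submodule (AW q) (Pullback hq V) where
  carrier := {w | (DAHA.t q 0 : DAHA q) • (Pullback.of hq V).symm w =
    θ • (Pullback.of hq V).symm w}
  zero_mem' := by simp
  add_mem' := by
    intro v w hv hw
    simp only [Set.mem_ofPred_eq] at hv hw ⊢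
    rw [map_add, smul_add, smul_add, hv, hw]
  smul_mem' := by
    intro x v hv
    obtain ⟨v, rfl⟩ := (Pullback.of hq V).surjective v
    simp only [Set.mem_ofPred_eq, LinearEquiv.symm_apply_apply, Pullback.smul_of] at hv ⊢
    rw [← mul_smul, (t_zero_commute_zeta hq x).eq, mul_smul, hv, smul_comm]

/-- An endomorphism of a vector space is diagonalizable if its eigenvectors span the space. -/
def IsDiagonalizable {W : Type*} [AddCommGroup W] [Module F W] (f : Module.End F W) : Prop :=
  (⨆ μ : F, f.eigenspace μ) = ⊤

end Modules

end AskeyWilson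

/-! By Schur's lemma every `t i + (t i)⁻¹` acts on `V` as a scalar `c i`, so each `t i` satisfies a
quadratic equation. Let `θ, θ'` be the roots of `X² - c 0 X + 1`, so that `(t 0 - θ)(t 0 - θ') = 0`.
A `△_q`-submodule is a subspace stable under the three operators `symOp`.

Two dual facts control such subspaces. If `W ≠ 0` is also stable under `t 0`, then `W + ∑ t i W` is
all of `V`; if `W ≠ V`, no nonzero vector of `W` has all its translates in `W`
(`translates_invariant`, `eq_zero_of_translates_mem`). Consequently a nonzero submodule of `V(θ)`
contains the range of `t 0 - θ'`; and when `θ = θ'`, a proper `t 0`-stable submodule containing the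
range of `t 0 - θ` lies in `V(θ)`.

Stability under `t 0` is not automatic. The Askey--Wilson relations express `c i • t 0`, for `i ≠
0`, through the `symOp`. If `c 1 = c 2 = c 3 = 0`, then `det (t i)` is a root of unity for `i ≠ 0`.
Since the four determinants multiply to `q⁻¹ ^ dim V`, this cannot happen when `det (t 0)` is a root
of unity, which holds in each case where stability is needed.

If `θ ≠ θ'`, then `V = V(θ) ⊕ V(θ')` and each nonzero summand is irreducible. A further submodule
would be a common complement of both, which forces `det (t 0) = 1`, hence stability under `t 0`,
hence a contradiction.

If `θ = θ'`, then `θ = ±1`, and every submodule is `V` or lies in `V(θ)`, where the range of `t 0 -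
θ` is the smallest nonzero one when `t 0` is not scalar. Its codimension in `V(θ)` is `0` or `1`
according to the parity of `dim V`, because `2 dim V(θ) ≤ dim V + 1`
(`two_mul_finrank_eigenspace_le`). This bound comes from determinants: a larger `V(θ)` would share
an eigenvector with each `t i`, and a common eigenvector generates a basis in which `t 0 * t 1` is
triangular with explicit diagonal (`det_mul_of_common_eigenvector`). -/

namespace AskeyWilson

/-! ### Operators satisfying the relations of `ℌ_q` irreducibly -/

section Operators

variable {F V : Type*} [Field F] [AddCommGroup V] [Module F V]

/-- Operators on `V` that make it an irreducible `ℌ_q`-module on which `t_i + t_i⁻¹` acts as the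
scalar `c i`. -/
structure IsDAHATuple (q : F) (t : Fin 4 → Module.End F V) (c : Fin 4 → F) : Prop where
  quad : ∀ i, t i * t i = c i • t i - 1
  prod : t 0 * t 1 * t 2 * t 3 = q⁻¹ • 1
  irred : ∀ W : Submodule F V, (∀ i, ∀ w ∈ W, t i w ∈ W) → W = ⊥ ∨ W = ⊤

/-- The inverse of an operator `f` with `f² = c f - 1`. -/
def qinv (c : F) (f : Module.End F V) : Module.End F V := c • 1 - f

/-- The operator `t_i t_0 + (t_i t_0)⁻¹`. -/
def symOp (t : Fin 4 → Module.End F V) (c : Fin 4 → F) (i : Fin 4) : Module.End F V :=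
  t i * t 0 + qinv (c 0) (t 0) * qinv (c i) (t i)

theorem mul_qinv {c : F} {f : Module.End F V} (h : f * f = c • f - 1) : f * qinv c f = 1 := by
  simp [qinv, mul_sub, h]

theorem qinv_mul {c : F} {f : Module.End F V} (h : f * f = c • f - 1) : qinv c f * f = 1 := by
  simp [qinv, sub_mul, h]

theorem qinv_apply (c : F) (f : Module.End F V) (v : V) : qinv c f v = c • v - f v := rfl

/-- The expansion `t i * t 0 + t 0 * t i - c i • t 0 - c 0 • t i + (c 0 * c i) • 1` is symmetric in
the two factors. The two forms are used to reach `t 0 (t i w)` and `t i (t 0 w)` respectively. -/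
theorem symOp_eq (t : Fin 4 → Module.End F V) (c : Fin 4 → F) (i : Fin 4) :
    symOp t c i = t 0 * t i + qinv (c i) (t i) * qinv (c 0) (t 0) := by
  simp only [symOp, qinv, sub_mul, mul_sub, smul_mul_assoc, mul_smul_comm, one_mul, mul_one]
  module

theorem qinv_mem_iff {W : Submodule F V} {c : F} {f : Module.End F V} {v : V} (hv : v ∈ W) :
    qinv c f v ∈ W ↔ f v ∈ W := by
  rw [qinv_apply, Submodule.sub_mem_iff_right _ (W.smul_mem _ hv)]

namespace IsDAHATuple

variable {q : F} {t : Fin 4 → Module.End F V} {c : Fin 4 → F}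

/-! ### Cyclic forms of the product relation, and symmetries of the tuple -/

section Relations

variable (H : IsDAHATuple q t c)
include H

theorem mul_inv (i : Fin 4) (x : Module.End F V) : t i * (qinv (c i) (t i) * x) = x := by
  rw [← mul_assoc, mul_qinv (H.quad i), one_mul]

theorem inv_mul (i : Fin 4) (x : Module.End F V) : qinv (c i) (t i) * (t i * x) = x := by
  rw [← mul_assoc, qinv_mul (H.quad i), one_mul]

theorem mul_inv_apply (i : Fin 4) (x : V) : t i (qinv (c i) (t i) x) = x :=
  LinearMap.congr_fun (mul_qinv (H.quad i)) x

theorem inv_mul_apply (i : Fin 4) (x : V) : qinv (c i) (t i) (t i x) = x :=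
  LinearMap.congr_fun (qinv_mul (H.quad i)) x

theorem rel_one_two_three : t 1 * (t 2 * t 3) = q⁻¹ • qinv (c 0) (t 0) := by
  have h := congrArg (qinv (c 0) (t 0) * ·) H.prod
  simpa only [mul_assoc, H.inv_mul, mul_smul_comm, mul_one] using h

theorem rel_one_two : t 1 * t 2 = q⁻¹ • (qinv (c 0) (t 0) * qinv (c 3) (t 3)) := by
  have h := congrArg (· * qinv (c 3) (t 3)) H.rel_one_two_three
  simpa only [mul_assoc, mul_qinv (H.quad 3), smul_mul_assoc, mul_one] using h

theorem rel_two_three : t 2 * t 3 = q⁻¹ • (qinv (c 1) (t 1) * qinv (c 0) (t 0)) := by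
  have h := congrArg (qinv (c 1) (t 1) * ·) H.rel_one_two_three
  simpa only [H.inv_mul, mul_smul_comm] using h

theorem rel_zero_one : t 0 * t 1 = q⁻¹ • (qinv (c 3) (t 3) * qinv (c 2) (t 2)) := by
  have h := congrArg (· * (qinv (c 3) (t 3) * qinv (c 2) (t 2))) H.prod
  simpa only [mul_assoc, H.mul_inv, mul_qinv (H.quad 2), smul_mul_assoc, mul_one, one_mul] using h

theorem rel_three_zero : t 3 * t 0 = q⁻¹ • (qinv (c 2) (t 2) * qinv (c 1) (t 1)) := by
  have h := congrArg (qinv (c 2) (t 2) * qinv (c 1) (t 1) * · * t 0) H.rel_one_two_three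
  simpa only [mul_assoc, H.inv_mul, mul_smul_comm, smul_mul_assoc, qinv_mul (H.quad 0),
    mul_one] using h

theorem rel_three_zero_one : t 3 * (t 0 * t 1) = q⁻¹ • qinv (c 2) (t 2) := by
  rw [H.rel_zero_one, mul_smul_comm, H.mul_inv]

theorem rel_inv (hq : q ≠ 0) :
    qinv (c 1) (t 1) * (qinv (c 0) (t 0) * qinv (c 3) (t 3)) = q • t 2 := by
  have h := congrArg (fun x => q • (qinv (c 1) (t 1) * x)) H.rel_one_two
  simp only [H.inv_mul, mul_smul_comm, smul_smul, mul_inv_cancel₀ hq, one_smul] at h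
  exact h.symm

theorem det_prod [FiniteDimensional F V] :
    LinearMap.det (t 0) * LinearMap.det (t 1) * LinearMap.det (t 2) * LinearMap.det (t 3) =
      q⁻¹ ^ Module.finrank F V := by
  rw [← map_mul, ← map_mul, ← map_mul, H.prod, LinearMap.det_smul, map_one, mul_one]

/-- Rotating the tuple. -/
theorem rotate : IsDAHATuple q ![t 3, t 0, t 1, t 2] ![c 3, c 0, c 1, c 2] where
  quad i := by fin_cases i <;> exact H.quad _
  prod := by
    simp only [Matrix.cons_val]
    rw [mul_assoc, mul_assoc, H.rel_one_two, mul_smul_comm, H.mul_inv, mul_smul_comm,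
      mul_qinv (H.quad 3)]
  irred W hW := H.irred W fun i => by
    fin_cases i
    exacts [hW 1, hW 2, hW 3, hW 0]

/-- Moving `t_2` past `t_1`. -/
theorem braid : IsDAHATuple q ![t 0, t 2, qinv (c 2) (t 2) * t 1 * t 2, t 3]
    ![c 0, c 2, c 1, c 3] where
  quad i := by
    fin_cases i
    · exact H.quad _
    · exact H.quad _
    · change qinv (c 2) (t 2) * t 1 * t 2 * (qinv (c 2) (t 2) * t 1 * t 2) =
        c 1 • (qinv (c 2) (t 2) * t 1 * t 2) - 1
      simp only [mul_assoc, H.mul_inv]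
      rw [← mul_assoc (t 1) (t 1), H.quad 1, sub_mul, mul_sub, one_mul, qinv_mul (H.quad 2),
        smul_mul_assoc, mul_smul_comm]
    · exact H.quad _
  prod := by
    simp only [Matrix.cons_val, mul_assoc, H.mul_inv]
    simpa only [mul_assoc] using H.prod
  irred W hW := H.irred W fun i w hw => by
    have h2 : ∀ x ∈ W, t 2 x ∈ W := hW 1
    have hu : ∀ x ∈ W, qinv (c 2) (t 2) x ∈ W := fun x hx => (qinv_mem_iff hx).2 (h2 x hx)
    fin_cases i
    · exact hW 0 w hw
    · have h := h2 _ (hW 2 _ (hu w hw))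
      simpa [H.mul_inv_apply] using h
    · exact h2 w hw
    · exact hW 3 w hw

end Relations

/-! ### Subspaces stable under `t 0` and the `symOp`, and their translates -/

section Generation

/-- The span of `W` and its translates is an `ℌ_q`-submodule. -/
theorem translates_invariant (H : IsDAHATuple q t c) (hq : q ≠ 0) {W : Submodule F V}
    (h0 : ∀ w ∈ W, t 0 w ∈ W) (hS : ∀ i ≠ 0, ∀ w ∈ W, symOp t c i w ∈ W)
    (hne : W ≠ ⊥) : W ⊔ ⨆ i, W.map (t i) = ⊤ := by
  set M := W ⊔ ⨆ i, W.map (t i) with hM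
  have hW : ∀ w ∈ W, w ∈ M := fun w hw => (le_sup_left : W ≤ M) hw
  have hT : ∀ i, ∀ w ∈ W, t i w ∈ M := fun i w hw =>
    (le_sup_right : _ ≤ M) (Submodule.mem_iSup_of_mem i (Submodule.mem_map_of_mem hw))
  have hU : ∀ i, ∀ w ∈ W, qinv (c i) (t i) w ∈ M := fun i w hw =>
    (qinv_mem_iff (hW w hw)).2 (hT i w hw)
  have hU0 : ∀ w ∈ W, qinv (c 0) (t 0) w ∈ W := fun w hw => (qinv_mem_iff hw).2 (h0 w hw)
  -- Replacing a factor by its inverse changes its sign and adds a term already in `M`. So in a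
  -- product of two factors either one may be inverted freely.
  have key : ∀ i j, (∀ w ∈ W, t i (t j w) ∈ M) ↔
      ∀ w ∈ W, t i (qinv (c j) (t j) w) ∈ M := fun i j => by
    refine forall₂_congr fun w hw => ?_
    rw [qinv_apply, map_sub, map_smul,
      Submodule.sub_mem_iff_right _ (M.smul_mem _ (hT i w hw))]
  have key' : ∀ i j, (∀ w ∈ W, t i (t j w) ∈ M) ↔
      ∀ w ∈ W, qinv (c i) (t i) (t j w) ∈ M := fun i j =>
    forall₂_congr fun w hw => (qinv_mem_iff (hT j w hw)).symm
  have key'' : ∀ i j, (∀ w ∈ W, t i (t j w) ∈ M) ↔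
      ∀ w ∈ W, qinv (c i) (t i) (qinv (c j) (t j) w) ∈ M := fun i j => (key i j).trans <|
    forall₂_congr fun w hw => (qinv_mem_iff (hU j w hw)).symm
  have a0 : ∀ i, ∀ w ∈ W, t i (t 0 w) ∈ M := fun i w hw => hT i _ (h0 w hw)
  have b0 : ∀ i ≠ 0, ∀ w ∈ W, t 0 (t i w) ∈ M := fun i hi w hw => by
    have h := hW _ (hS i hi w hw)
    rw [symOp_eq] at h
    exact (Submodule.add_mem_iff_left _ (hU i _ (hU0 w hw))).1 h
  have dg : ∀ i, ∀ w ∈ W, t i (t i w) ∈ M := fun i w hw => by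
    have h := LinearMap.congr_fun (H.quad i) w
    change t i (t i w) = c i • t i w - w at h
    rw [h]
    exact M.sub_mem (M.smul_mem _ (hT i w hw)) (hW w hw)
  -- Cyclically adjacent pairs: the product relation trades them for a pair involving the index `0`.
  have h12 : ∀ w ∈ W, t 1 (t 2 w) ∈ M := fun w hw => by
    have h := LinearMap.congr_fun H.rel_one_two w
    change t 1 (t 2 w) = q⁻¹ • qinv (c 0) (t 0) (qinv (c 3) (t 3) w) at h
    rw [h]
    exact M.smul_mem _ ((key'' 0 3).1 (b0 3 (by decide)) w hw)
  have h23 : ∀ w ∈ W, t 2 (t 3 w) ∈ M := fun w hw => by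
    have h := LinearMap.congr_fun H.rel_two_three w
    change t 2 (t 3 w) = q⁻¹ • qinv (c 1) (t 1) (qinv (c 0) (t 0) w) at h
    rw [h]
    exact M.smul_mem _ ((key'' 1 0).1 (a0 1) w hw)
  have h21 : ∀ w ∈ W, t 2 (t 1 w) ∈ M := (key'' 2 1).2 fun w hw => by
    have h := LinearMap.congr_fun H.rel_three_zero w
    change t 3 (t 0 w) = q⁻¹ • qinv (c 2) (t 2) (qinv (c 1) (t 1) w) at h
    rw [← Submodule.smul_mem_iff _ (inv_ne_zero hq), ← h]
    exact a0 3 w hw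
  have h32 : ∀ w ∈ W, t 3 (t 2 w) ∈ M := (key'' 3 2).2 fun w hw => by
    have h := LinearMap.congr_fun H.rel_zero_one w
    change t 0 (t 1 w) = q⁻¹ • qinv (c 3) (t 3) (qinv (c 2) (t 2) w) at h
    rw [← Submodule.smul_mem_iff _ (inv_ne_zero hq), ← h]
    exact b0 1 (by decide) w hw
  -- For the opposite pair, apply `t 3` to `symOp t c 1 (t 0 w)`. One summand collapses to a
  -- multiple of the inverse of `t 2` since `t 3 * t 0 * t 1` does, and the other is `t 3` after the
  -- inverse of `t 1`, the argument `t 0 w` having cancelled the inverse of `t 0`.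
  have h31 : ∀ w ∈ W, t 3 (t 1 w) ∈ M := (key 3 1).2 fun w hw => by
    have h := LinearMap.congr_fun H.rel_three_zero_one (t 0 w)
    change t 3 (t 0 (t 1 (t 0 w))) = q⁻¹ • qinv (c 2) (t 2) (t 0 w) at h
    have h' := hT 3 _ (hS 1 (by decide) _ (h0 w hw))
    rw [symOp_eq, LinearMap.add_apply, map_add, Module.End.mul_apply, Module.End.mul_apply, h,
      H.inv_mul_apply] at h'
    exact (Submodule.add_mem_iff_right _ (M.smul_mem _ (hU 2 _ (h0 w hw)))).1 h'
  have h13 : ∀ w ∈ W, t 1 (t 3 w) ∈ M := (key' 1 3).2 fun w hw => by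
    have hw' := hU0 w hw
    have h := LinearMap.congr_fun (H.rel_inv hq) (qinv (c 0) (t 0) w)
    change qinv (c 1) (t 1) (qinv (c 0) (t 0) (qinv (c 3) (t 3) (qinv (c 0) (t 0) w))) =
      q • t 2 (qinv (c 0) (t 0) w) at h
    have h' := hU 1 _ (hS 3 (by decide) _ hw')
    rw [symOp, LinearMap.add_apply, map_add, Module.End.mul_apply, Module.End.mul_apply, h,
      H.mul_inv_apply] at h'
    exact (Submodule.add_mem_iff_left _ (M.smul_mem _ (hT 2 _ hw'))).1 h'
  have hall : ∀ i j, ∀ w ∈ W, t i (t j w) ∈ M := by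
    intro i j
    fin_cases i <;> fin_cases j
    exacts [dg 0, b0 1 (by decide), b0 2 (by decide), b0 3 (by decide), a0 1, dg 1, h12, h13,
      a0 2, h21, dg 2, h23, a0 3, h31, h32, dg 3]
  refine (H.irred M fun i => ?_).resolve_left fun h => hne ?_
  · change M ≤ M.comap (t i)
    refine sup_le (fun w hw => hT i w hw) (iSup_le fun j => ?_)
    rintro _ ⟨w, hw, rfl⟩
    exact hall i j w hw
  · exact le_bot_iff.1 (h ▸ le_sup_left)

/-- The vectors all of whose translates lie in a proper subspace `W` form an `ℌ_q`-submodule. -/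
theorem eq_zero_of_translates_mem (H : IsDAHATuple q t c) (hq : q ≠ 0) {W : Submodule F V}
    (h0 : ∀ w ∈ W, t 0 w ∈ W) (hS : ∀ i ≠ 0, ∀ w ∈ W, symOp t c i w ∈ W)
    (hne : W ≠ ⊤) {v : V} (hv : v ∈ W) (hvt : ∀ i, t i v ∈ W) : v = 0 := by
  set Y := W ⊓ ⨅ i, W.comap (t i) with hY
  have memY : ∀ x, x ∈ Y ↔ x ∈ W ∧ ∀ i, t i x ∈ W := fun x => by simp [hY]
  have hW : ∀ x ∈ Y, x ∈ W := fun x hx => ((memY x).1 hx).1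
  have hT : ∀ i, ∀ x ∈ Y, t i x ∈ W := fun i x hx => ((memY x).1 hx).2 i
  have hU : ∀ i, ∀ x ∈ Y, qinv (c i) (t i) x ∈ W := fun i x hx =>
    (qinv_mem_iff (hW x hx)).2 (hT i x hx)
  have hU0 : ∀ w ∈ W, qinv (c 0) (t 0) w ∈ W := fun w hw => (qinv_mem_iff hw).2 (h0 w hw)
  have key : ∀ i j, (∀ w ∈ Y, t i (t j w) ∈ W) ↔
      ∀ w ∈ Y, t i (qinv (c j) (t j) w) ∈ W := fun i j => by
    refine forall₂_congr fun w hw => ?_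
    rw [qinv_apply, map_sub, map_smul,
      Submodule.sub_mem_iff_right _ (W.smul_mem _ (hT i w hw))]
  have key' : ∀ i j, (∀ w ∈ Y, t i (t j w) ∈ W) ↔
      ∀ w ∈ Y, qinv (c i) (t i) (t j w) ∈ W := fun i j =>
    forall₂_congr fun w hw => (qinv_mem_iff (hT j w hw)).symm
  have key'' : ∀ i j, (∀ w ∈ Y, t i (t j w) ∈ W) ↔
      ∀ w ∈ Y, qinv (c i) (t i) (qinv (c j) (t j) w) ∈ W := fun i j => (key i j).trans <|
    forall₂_congr fun w hw => (qinv_mem_iff (hU j w hw)).symm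
  have b0 : ∀ i, ∀ w ∈ Y, t 0 (t i w) ∈ W := fun i w hw => h0 _ (hT i w hw)
  -- Dually to the previous argument, `t 0` on the left is now harmless and `t 0` on the right is
  -- what needs `symOp`.
  have a0 : ∀ i ≠ 0, ∀ w ∈ Y, t i (t 0 w) ∈ W := fun i hi w hw => by
    have h := hS i hi w (hW w hw)
    exact (Submodule.add_mem_iff_left _ (hU0 _ (hU i w hw))).1 h
  have dg : ∀ i, ∀ w ∈ Y, t i (t i w) ∈ W := fun i w hw => by
    have h := LinearMap.congr_fun (H.quad i) w
    change t i (t i w) = c i • t i w - w at h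
    rw [h]
    exact W.sub_mem (W.smul_mem _ (hT i w hw)) (hW w hw)
  have h12 : ∀ w ∈ Y, t 1 (t 2 w) ∈ W := fun w hw => by
    have h := LinearMap.congr_fun H.rel_one_two w
    change t 1 (t 2 w) = q⁻¹ • qinv (c 0) (t 0) (qinv (c 3) (t 3) w) at h
    rw [h]
    exact W.smul_mem _ (hU0 _ (hU 3 w hw))
  have h23 : ∀ w ∈ Y, t 2 (t 3 w) ∈ W := fun w hw => by
    have h := LinearMap.congr_fun H.rel_two_three w
    change t 2 (t 3 w) = q⁻¹ • qinv (c 1) (t 1) (qinv (c 0) (t 0) w) at h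
    rw [h]
    exact W.smul_mem _ ((key'' 1 0).1 (a0 1 (by decide)) w hw)
  have h21 : ∀ w ∈ Y, t 2 (t 1 w) ∈ W := (key'' 2 1).2 fun w hw => by
    have h := LinearMap.congr_fun H.rel_three_zero w
    change t 3 (t 0 w) = q⁻¹ • qinv (c 2) (t 2) (qinv (c 1) (t 1) w) at h
    rw [← Submodule.smul_mem_iff _ (inv_ne_zero hq), ← h]
    exact a0 3 (by decide) w hw
  have h32 : ∀ w ∈ Y, t 3 (t 2 w) ∈ W := (key'' 3 2).2 fun w hw => by
    have h := LinearMap.congr_fun H.rel_zero_one w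
    change t 0 (t 1 w) = q⁻¹ • qinv (c 3) (t 3) (qinv (c 2) (t 2) w) at h
    rw [← Submodule.smul_mem_iff _ (inv_ne_zero hq), ← h]
    exact b0 1 w hw
  -- Here `symOp t c 3` acts on `t 1 w`, which already lies in `W`; the leading inverse of `t 0` is
  -- stripped afterwards because `W` is stable under `t 0`.
  have h31 : ∀ w ∈ Y, t 3 (t 1 w) ∈ W := (key' 3 1).2 fun w hw => by
    have h := LinearMap.congr_fun H.rel_three_zero_one w
    change t 3 (t 0 (t 1 w)) = q⁻¹ • qinv (c 2) (t 2) w at h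
    have h' := hS 3 (by decide) _ (hT 1 w hw)
    rw [symOp, LinearMap.add_apply, Module.End.mul_apply, Module.End.mul_apply, h] at h'
    have h'' := h0 _ ((Submodule.add_mem_iff_right _ (W.smul_mem _ (hU 2 w hw))).1 h')
    rwa [H.mul_inv_apply] at h''
  have h13 : ∀ w ∈ Y, t 1 (t 3 w) ∈ W := (key 1 3).2 fun w hw => by
    have h := LinearMap.congr_fun (H.rel_inv hq) w
    change qinv (c 1) (t 1) (qinv (c 0) (t 0) (qinv (c 3) (t 3) w)) = q • t 2 w at h
    have h' := hS 1 (by decide) _ (hU 3 w hw)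
    rw [symOp_eq, LinearMap.add_apply, Module.End.mul_apply, Module.End.mul_apply, h] at h'
    have h'' := hU0 _ ((Submodule.add_mem_iff_left _ (W.smul_mem _ (hT 2 w hw))).1 h')
    rwa [H.inv_mul_apply] at h''
  have hall : ∀ i j, ∀ w ∈ Y, t i (t j w) ∈ W := by
    intro i j
    fin_cases i <;> fin_cases j
    exacts [dg 0, b0 1, b0 2, b0 3, a0 1 (by decide), dg 1, h12, h13,
      a0 2 (by decide), h21, dg 2, h23, a0 3 (by decide), h31, h32, dg 3]
  have hYbot : Y = ⊥ :=
    (H.irred Y fun j x hx => (memY _).2 ⟨hT j x hx, fun i => hall i j x hx⟩).resolve_right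
      fun h => hne (top_le_iff.1 (h ▸ inf_le_left))
  exact (Submodule.mem_bot F).1 (hYbot ▸ (memY v).2 ⟨hv, hvt⟩)

end Generation

end IsDAHATuple

end Operators

end AskeyWilson

namespace AskeyWilson

/-! ### Determinants of quadratic and of triangular operators -/

section Determinants

variable {F V : Type*} [Field F] [AddCommGroup V] [Module F V] [FiniteDimensional F V]

/-- The range of `f - b` lies in the `a`-eigenspace, so `f` acts as `a` on that eigenspace and as
`b` on the quotient by it. The case `a = b` is included. -/
theorem det_of_quadratic {f : Module.End F V} {a b : F}
    (h : ∀ v, f (f v - b • v) = a • (f v - b • v)) :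
    LinearMap.det f = a ^ Module.finrank F (f.eigenspace a) *
      b ^ (Module.finrank F V - Module.finrank F (f.eigenspace a)) := by
  set W := f.eigenspace a with hW
  have hle : W ≤ W.comap f := fun w hw => by
    rw [Submodule.mem_comap, Module.End.mem_eigenspace_iff.1 hw]
    exact W.smul_mem _ hw
  rw [LinearMap.det_eq_det_mul_det W f hle]
  have h1 : f.restrict hle = a • (1 : Module.End F W) := by
    ext w
    exact Module.End.mem_eigenspace_iff.1 w.2
  have h2 : W.mapQ W f hle = b • (1 : Module.End F (V ⧸ W)) := by
    ext v
    change W.mkQ (f v) = b • W.mkQ v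
    rw [← map_smul, ← sub_eq_zero, ← map_sub, ← LinearMap.mem_ker, Submodule.ker_mkQ]
    exact Module.End.mem_eigenspace_iff.2 (h v)
  rw [h1, h2, LinearMap.det_smul, LinearMap.det_smul, map_one, map_one, mul_one, mul_one,
    Submodule.finrank_quotient]

/-- The determinant of an operator that is triangular along a sequence of vectors. -/
theorem det_of_triangular {f : Module.End F V} {v : ℕ → V} {e : ℕ → F}
    (hv : ∀ n < Module.finrank F V, v n ∉ Submodule.span F (v '' Set.Iio n))
    (hf : ∀ n, f (v n) - e n • v n ∈ Submodule.span F (v '' Set.Iio n)) :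
    LinearMap.det f = ∏ n ∈ Finset.range (Module.finrank F V), e n := by
  have hli : ∀ n ≤ Module.finrank F V, LinearIndependent F fun i : Fin n => v i := by
    intro n hn
    induction n with
    | zero => exact linearIndependent_empty_type
    | succ n ih =>
      rw [linearIndependent_finSucc']
      refine ⟨ih (by omega), ?_⟩
      rw [Fin.val_last]
      convert hv n (by omega) using 3
      ext x
      constructor
      · rintro ⟨i, rfl⟩
        exact ⟨i, i.2, rfl⟩
      · rintro ⟨i, hi, rfl⟩
        exact ⟨⟨i, hi⟩, rfl⟩
  set b := basisOfLinearIndependentOfCardEqFinrank' _ (hli _ le_rfl) (by simp) with hb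
  have hbv : ∀ i, b i = v i := fun i => by simp [hb]
  have hrep : ∀ (n : ℕ) (i : Fin (Module.finrank F V)), n ≤ i →
      ∀ w ∈ Submodule.span F (v '' Set.Iio n), b.repr w i = 0 := by
    intro n i hi w hw
    induction hw using Submodule.span_induction with
    | mem x hx =>
      obtain ⟨j, hj, rfl⟩ := hx
      have hj' : j < n := hj
      rw [← hbv ⟨j, by omega⟩, b.repr_self, Finsupp.single_apply, if_neg]
      intro h
      rw [← h] at hi
      exact absurd hj' (by simpa using hi)
    | zero => simp
    | add x y _ _ hx hy => simp [hx, hy]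
    | smul r x _ hx => simp [hx]
  have hent : ∀ i j : Fin (Module.finrank F V), j ≤ i →
      LinearMap.toMatrix b b f i j = e j * if j = i then 1 else 0 := fun i j hij => by
    have h := hrep j i hij _ (hf j)
    rw [map_sub, Finsupp.sub_apply, sub_eq_zero, map_smul, ← hbv, b.repr_self, Finsupp.smul_apply,
      Finsupp.single_apply, smul_eq_mul] at h
    rw [LinearMap.toMatrix_apply, h]
  rw [← LinearMap.det_toMatrix b, Matrix.det_of_isUpperTriangular, ← Fin.prod_univ_eq_prod_range]
  · exact Finset.prod_congr rfl fun i _ => by rw [hent i i le_rfl, if_pos rfl, mul_one]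
  · intro i j hij
    have hij' : j < i := hij
    rw [hent i j hij'.le, if_neg hij'.ne, mul_zero]

end Determinants

/-! ### The chain generated by a common eigenvector of `t 0` and `t 1` -/

section Chain

variable {F V : Type*} [Field F] [AddCommGroup V] [Module F V]

/-- The operator that extends the chain of vectors at its `n`-th place. -/
def chainStep (t : Fin 4 → Module.End F V) (n : ℕ) : Module.End F V :=
  if Even n then t 2 else t 0

/-- The chain `v, t₂v, t₀t₂v, t₂t₀t₂v, …`. -/
def chain (t : Fin 4 → Module.End F V) (v : V) : ℕ → V
  | 0 => v
  | n + 1 => chainStep t n (chain t v n)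

/-- The eigenvalues of `t₀t₁` along the chain. -/
def chainEigenvalue (q x : F) : ℕ → F
  | 0 => x
  | n + 1 => if Even n then q⁻¹ ^ 2 * (chainEigenvalue q x n)⁻¹ else (chainEigenvalue q x n)⁻¹

theorem chainStep_add_two (t : Fin 4 → Module.End F V) (n : ℕ) :
    chainStep t (n + 2) = chainStep t n := by
  simp [chainStep, Nat.even_add]

theorem chainEigenvalue_ne_zero {q x : F} (hq : q ≠ 0) (hx : x ≠ 0) (n : ℕ) :
    chainEigenvalue q x n ≠ 0 := by
  induction n with
  | zero => exact hx
  | succ n ih =>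
    rw [chainEigenvalue]
    split_ifs
    · exact mul_ne_zero (pow_ne_zero _ (inv_ne_zero hq)) (inv_ne_zero ih)
    · exact inv_ne_zero ih

/-- Consecutive eigenvalues cancel up to a power of `q`: the product of a pair is `q⁻¹ ^ 2` if it
begins at an even index and `1` if it begins at an odd one. -/
theorem prod_chainEigenvalue {q x : F} (hq : q ≠ 0) (hx : x ≠ 0) (m : ℕ) :
    ∏ n ∈ Finset.range (2 * m), chainEigenvalue q x n = q⁻¹ ^ (2 * m) ∧
    ∏ n ∈ Finset.range (2 * m + 1), chainEigenvalue q x n = x := by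
  have hne := chainEigenvalue_ne_zero hq hx
  induction m with
  | zero => simp [chainEigenvalue]
  | succ m ih =>
    have e1 : chainEigenvalue q x (2 * m + 1) = q⁻¹ ^ 2 * (chainEigenvalue q x (2 * m))⁻¹ := by
      rw [chainEigenvalue, if_pos (even_two_mul m)]
    have e2 : chainEigenvalue q x (2 * m + 2) = (chainEigenvalue q x (2 * m + 1))⁻¹ := by
      rw [chainEigenvalue, if_neg (by simp)]
    rw [show 2 * (m + 1) = 2 * m + 1 + 1 by ring]
    constructor
    · rw [Finset.prod_range_succ, Finset.prod_range_succ, ih.1, e1, mul_assoc,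
        mul_left_comm (chainEigenvalue q x (2 * m)), mul_inv_cancel₀ (hne _), mul_one, ← pow_add]
    · rw [Finset.prod_range_succ, Finset.prod_range_succ, ih.2, e2, mul_assoc,
        mul_inv_cancel₀ (hne _), mul_one]

theorem span_image_Iio_succ (v : ℕ → V) (n : ℕ) :
    Submodule.span F (v '' Set.Iio (n + 1)) =
      Submodule.span F (v '' Set.Iio n) ⊔ Submodule.span F {v n} := by
  rw [← Submodule.span_union, ← Set.image_singleton, ← Set.image_union]
  congr 2
  ext i
  simp

theorem span_sup_singleton_invariant {W : Submodule F V} {f : Module.End F V} {v : V}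
    (hW : ∀ w ∈ W, f w ∈ W) (hv : f v ∈ W ⊔ Submodule.span F {v}) :
    ∀ w ∈ W ⊔ Submodule.span F {v}, f w ∈ W ⊔ Submodule.span F {v} := by
  change W ⊔ Submodule.span F {v} ≤ (W ⊔ Submodule.span F {v}).comap f
  refine sup_le (fun w hw => Submodule.mem_sup_left (hW w hw)) ?_
  rw [Submodule.span_singleton_le_iff_mem]
  exact hv

namespace IsDAHATuple

variable {q : F} {t : Fin 4 → Module.End F V} {c : Fin 4 → F}

theorem chainStep_sq (H : IsDAHATuple q t c) (n : ℕ) :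
    ∃ r : F, ∀ w, chainStep t n (chainStep t n w) = r • chainStep t n w - w := by
  rw [chainStep]
  split_ifs
  · exact ⟨c 2, LinearMap.congr_fun (H.quad 2)⟩
  · exact ⟨c 0, LinearMap.congr_fun (H.quad 0)⟩

/-- With `X = t 0 * t 1`, moving `X` past a chain step turns it into `X⁻¹`, up to a scalar and a
combination of `1`, `X`, `X⁻¹`. This is why eigenvalues along the chain alternate with their
inverses. For `t 2` it follows from `X⁻¹ = q • (t 2 * t 3)`, for `t 0` from the quadratic relations
alone. -/
theorem prod_mul_chainStep (H : IsDAHATuple q t c) (hq : q ≠ 0) (n : ℕ) :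
    ∃ r₁ r₂ r₃ : F, t 0 * t 1 * chainStep t n =
      (if Even n then q⁻¹ ^ 2 else 1) •
        (chainStep t n * (qinv (c 1) (t 1) * qinv (c 0) (t 0))) +
      r₁ • 1 + r₂ • (t 0 * t 1) + r₃ • (qinv (c 1) (t 1) * qinv (c 0) (t 0)) := by
  rw [chainStep]
  split_ifs
  · refine ⟨q⁻¹ * c 3, 0, -(q⁻¹ ^ 2 * c 2), ?_⟩
    have e : qinv (c 1) (t 1) * qinv (c 0) (t 0) = q • (t 2 * t 3) := by
      rw [H.rel_two_three, smul_smul, mul_inv_cancel₀ hq, one_smul]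
    have e' : t 0 * t 1 * t 2 = q⁻¹ • qinv (c 3) (t 3) := by
      rw [H.rel_zero_one, smul_mul_assoc, mul_assoc, qinv_mul (H.quad 2), mul_one]
    have hq' : q⁻¹ ^ 2 * q = q⁻¹ := by field_simp
    rw [e, e', mul_smul_comm, ← mul_assoc, H.quad 2, qinv, sub_mul, smul_mul_assoc, one_mul,
      smul_smul, hq', smul_smul, neg_mul, mul_right_comm, hq']
    module
  · refine ⟨-c 1, c 0, 0, ?_⟩
    have e := H.quad 0
    simp only [qinv, mul_sub, sub_mul, smul_mul_assoc, mul_smul_comm, mul_one, one_mul, mul_assoc,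
      e]
    module

variable {θ a : F} {v : V}

/-- Counted down from index `n - 1`, the vectors form pairs `x, chainStep t n x`, each spanning a
stable subspace by the quadratic relation. For odd `n` the vector `v` is left over, and it is an
eigenvector of the step `t 0`. -/
theorem span_chain_invariant (H : IsDAHATuple q t c) (h0 : t 0 v = θ • v) (n : ℕ) :
    ∀ w ∈ Submodule.span F (chain t v '' Set.Iio n),
      chainStep t n w ∈ Submodule.span F (chain t v '' Set.Iio n) := by
  induction n using Nat.twoStepInduction with
  | zero => simp
  | one =>
    rw [span_image_Iio_succ]
    refine span_sup_singleton_invariant (by simp) ?_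
    refine le_sup_right (a := Submodule.span F (chain t v '' Set.Iio 0)) ?_
    change chainStep t 1 v ∈ Submodule.span F {v}
    rw [chainStep, if_neg (by simp), h0]
    exact Submodule.smul_mem _ _ (Submodule.mem_span_singleton_self v)
  | more n ih _ =>
    rw [span_image_Iio_succ, span_image_Iio_succ, chainStep_add_two, sup_assoc]
    set W := Submodule.span F (chain t v '' Set.Iio n)
    set x := chain t v n
    have hx : chain t v (n + 1) = chainStep t n x := rfl
    rw [hx]
    set M := W ⊔ (Submodule.span F {x} ⊔ Submodule.span F {chainStep t n x})
    have hxM : x ∈ M := (le_sup_left.trans le_sup_right : _ ≤ M)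
      (Submodule.mem_span_singleton_self x)
    have hyM : chainStep t n x ∈ M := (le_sup_right.trans le_sup_right : _ ≤ M)
      (Submodule.mem_span_singleton_self _)
    change M ≤ M.comap (chainStep t n)
    refine sup_le (fun w hw => (le_sup_left : W ≤ M) (ih w hw)) (sup_le ?_ ?_) <;>
      rw [Submodule.span_singleton_le_iff_mem, Submodule.mem_comap]
    · exact hyM
    · obtain ⟨r, hr⟩ := H.chainStep_sq n
      rw [hr]
      exact M.sub_mem (M.smul_mem _ hyM) hxM

/-- Stability under `X = t 0 * t 1` and under `X⁻¹` has to be carried along with triangularity,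
since the exchange relation computes `X` on the next vector from `X⁻¹` on the current one. -/
theorem chain_triangular (H : IsDAHATuple q t c) (hq : q ≠ 0) (h0 : t 0 v = θ • v)
    (h1 : t 1 v = a • v) (hx : θ * a ≠ 0) (n : ℕ) :
    (∀ w ∈ Submodule.span F (chain t v '' Set.Iio n),
      t 0 (t 1 w) ∈ Submodule.span F (chain t v '' Set.Iio n)) ∧
    (∀ w ∈ Submodule.span F (chain t v '' Set.Iio n),
      qinv (c 1) (t 1) (qinv (c 0) (t 0) w) ∈ Submodule.span F (chain t v '' Set.Iio n)) ∧
    t 0 (t 1 (chain t v n)) - chainEigenvalue q (θ * a) n • chain t v n ∈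
      Submodule.span F (chain t v '' Set.Iio n) := by
  induction n with
  | zero =>
    refine ⟨by simp, by simp, ?_⟩
    have : t 0 (t 1 v) - (θ * a) • v = 0 := by
      rw [h1, map_smul, h0, smul_smul, mul_comm, sub_self]
    exact this ▸ Submodule.zero_mem _
  | succ n ih =>
    obtain ⟨i1, i2, i3⟩ := ih
    have hs := H.span_chain_invariant h0 n
    have hne := chainEigenvalue_ne_zero hq hx n
    rw [span_image_Iio_succ]
    have hx' : chain t v (n + 1) = chainStep t n (chain t v n) := rfl
    rw [hx', chainEigenvalue]
    set W := Submodule.span F (chain t v '' Set.Iio n)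
    set x := chain t v n
    set e := chainEigenvalue q (θ * a) n
    set M := W ⊔ Submodule.span F {x}
    have hWM : ∀ w ∈ W, w ∈ M := fun w hw => (le_sup_left : W ≤ M) hw
    have hxM : x ∈ M := (le_sup_right : _ ≤ M) (Submodule.mem_span_singleton_self x)
    -- Obtained by applying `-e⁻¹ X⁻¹` to the congruence `X x ≡ e x` modulo `W`.
    have j3 : qinv (c 1) (t 1) (qinv (c 0) (t 0) x) - e⁻¹ • x ∈ W := by
      have h := W.smul_mem (-e⁻¹) (i2 _ i3)
      rw [map_sub, map_sub, map_smul, map_smul, H.inv_mul_apply, H.inv_mul_apply, smul_sub,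
        smul_smul, neg_mul, inv_mul_cancel₀ hne] at h
      convert h using 1
      module
    have k1 : t 0 (t 1 x) ∈ M := by
      have := M.add_mem (hWM _ i3) (M.smul_mem e hxM)
      rwa [sub_add_cancel] at this
    have k2 : qinv (c 1) (t 1) (qinv (c 0) (t 0) x) ∈ M := by
      have := M.add_mem (hWM _ j3) (M.smul_mem e⁻¹ hxM)
      rwa [sub_add_cancel] at this
    refine ⟨span_sup_singleton_invariant (f := t 0 * t 1) i1 k1,
      span_sup_singleton_invariant (f := qinv (c 1) (t 1) * qinv (c 0) (t 0)) i2 k2, ?_⟩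
    obtain ⟨r₁, r₂, r₃, hr⟩ := H.prod_mul_chainStep hq n
    have hr' := LinearMap.congr_fun hr x
    simp only [Module.End.mul_apply, LinearMap.add_apply, LinearMap.smul_apply,
      Module.End.one_apply] at hr'
    rw [hr']
    have hμ : (if Even n then q⁻¹ ^ 2 * e⁻¹ else e⁻¹) =
        (if Even n then q⁻¹ ^ 2 else 1) * e⁻¹ := by
      split_ifs <;> simp
    rw [hμ]
    generalize (if Even n then q⁻¹ ^ 2 else 1 : F) = μ
    have j4 := hs _ j3
    rw [map_sub, map_smul] at j4
    have := M.add_mem (M.add_mem (M.add_mem (M.smul_mem μ (hWM _ j4)) (M.smul_mem r₁ hxM))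
      (M.smul_mem r₂ k1)) (M.smul_mem r₃ k2)
    convert this using 1
    module

/-- At a first dependence the span of the earlier vectors equals the next span as well, so it is
stable under both kinds of step, `t 0` and `t 2`. Together with stability under `X` and `X⁻¹` this
gives `t 1` and `t 3`, and irreducibility forces the span, of dimension at most `n`, to be `V`. -/
theorem chain_notMem_span [FiniteDimensional F V] (H : IsDAHATuple q t c) (hq : q ≠ 0)
    (h0 : t 0 v = θ • v) (h1 : t 1 v = a • v) (hx : θ * a ≠ 0) (hv : v ≠ 0) {n : ℕ}
    (hn : n < Module.finrank F V) :
    chain t v n ∉ Submodule.span F (chain t v '' Set.Iio n) := by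
  intro hmem
  have hn0 : n ≠ 0 := by
    rintro rfl
    exact hv (by simpa [chain] using hmem)
  obtain ⟨i1, i2, -⟩ := H.chain_triangular hq h0 h1 hx n
  have s1 := H.span_chain_invariant h0 n
  have s2 := H.span_chain_invariant h0 (n + 1)
  rw [span_image_Iio_succ, sup_eq_left.2 ((Submodule.span_singleton_le_iff_mem _ _).2 hmem)] at s2
  have hv0 : v ∈ Submodule.span F (chain t v '' Set.Iio n) :=
    Submodule.subset_span ⟨0, Nat.pos_of_ne_zero hn0, rfl⟩
  have hdim : Module.finrank F (Submodule.span F (chain t v '' Set.Iio n)) ≤ n := by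
    classical
    have h := finrank_span_finset_le_card (R := F) ((Finset.range n).image (chain t v))
    rw [Finset.coe_image, Finset.coe_range] at h
    exact h.trans (Finset.card_image_le.trans (Finset.card_range n).le)
  set W := Submodule.span F (chain t v '' Set.Iio n)
  have h02 : (∀ w ∈ W, t 0 w ∈ W) ∧ ∀ w ∈ W, t 2 w ∈ W := by
    simp only [chainStep, Nat.even_add_one] at s1 s2
    split_ifs at s1 s2 with hpar
    · exact ⟨s2, s1⟩
    · exact ⟨s1, s2⟩
  have hinv : ∀ i, ∀ w ∈ W, t i w ∈ W := by
    intro i w hw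
    fin_cases i
    · exact h02.1 w hw
    · have h := (qinv_mem_iff (c := c 0) (i1 w hw)).2 (h02.1 _ (i1 w hw))
      rwa [H.inv_mul_apply] at h
    · exact h02.2 w hw
    · have h := LinearMap.congr_fun H.rel_two_three w
      change t 2 (t 3 w) = q⁻¹ • qinv (c 1) (t 1) (qinv (c 0) (t 0) w) at h
      have hm : t 2 (t 3 w) ∈ W := h ▸ W.smul_mem _ (i2 w hw)
      have h' := (qinv_mem_iff (c := c 2) hm).2 (h02.2 _ hm)
      rwa [H.inv_mul_apply] at h'
  rcases H.irred W hinv with h | h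
  · exact hv (by simpa [h] using hv0)
  · rw [h, finrank_top] at hdim
    omega

/-- The determinant of `t₀t₁` when `t₀` and `t₁` have a common eigenvector. -/
theorem det_mul_of_common_eigenvector [FiniteDimensional F V] (H : IsDAHATuple q t c)
    (hq : q ≠ 0) (h0 : t 0 v = θ • v) (h1 : t 1 v = a • v) (hx : θ * a ≠ 0) (hv : v ≠ 0) :
    LinearMap.det (t 0) * LinearMap.det (t 1) =
      if Even (Module.finrank F V) then q⁻¹ ^ Module.finrank F V else θ * a := by
  rw [← map_mul, det_of_triangular (fun n hn => H.chain_notMem_span hq h0 h1 hx hv hn)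
    (fun n => (H.chain_triangular hq h0 h1 hx n).2.2)]
  split_ifs with hpar
  · obtain ⟨m, hm⟩ := hpar.two_dvd
    rw [hm]
    exact (prod_chainEigenvalue hq hx m).1
  · obtain ⟨m, hm⟩ := Nat.not_even_iff_odd.1 hpar
    rw [hm]
    exact (prod_chainEigenvalue hq hx m).2

end IsDAHATuple

end Chain

end AskeyWilson

namespace AskeyWilson

/-! ### Consequences for `V(θ)`, stability under `t 0`, and dimension bounds -/

section Structure

variable {F V : Type*} [Field F] [AddCommGroup V] [Module F V]

theorem IsGeneric.not_isOfFinOrder {q : F} (hq : IsGeneric q) {n : ℕ} (hn : 0 < n) :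
    ¬ IsOfFinOrder (q⁻¹ ^ n) := by
  rw [isOfFinOrder_iff_pow_eq_one]
  rintro ⟨m, hm, h⟩
  rw [← pow_mul, inv_pow, inv_eq_one] at h
  exact hq.pow_ne_one _ (Nat.mul_pos hn hm) h

theorem isOfFinOrder_of_sq_eq_one {a : F} (h : a * a = 1) : IsOfFinOrder a :=
  isOfFinOrder_iff_pow_eq_one.2 ⟨2, two_pos, by rw [pow_two, h]⟩

theorem exists_mul_eq_one_add_eq [IsAlgClosed F] (c : F) : ∃ a b : F, a * b = 1 ∧ a + b = c := by
  obtain ⟨a, ha⟩ := IsAlgClosed.exists_root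
    (Polynomial.X ^ 2 - Polynomial.C c * Polynomial.X + 1 : Polynomial F) (by
      have : (Polynomial.X ^ 2 - Polynomial.C c * Polynomial.X + 1 : Polynomial F).degree = 2 := by
        compute_degree!
      rw [this]
      decide)
  simp only [Polynomial.IsRoot, Polynomial.eval_add, Polynomial.eval_sub, Polynomial.eval_pow,
    Polynomial.eval_X, Polynomial.eval_mul, Polynomial.eval_C, Polynomial.eval_one] at ha
  exact ⟨a, c - a, by linear_combination -ha, by ring⟩

section Quadratic

variable {f : Module.End F V} {c a b : F}

theorem apply_sub_of_quadratic (hf : f * f = c • f - 1) (hab : a * b = 1) (hc : a + b = c)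
    (v : V) : f (f v - b • v) = a • (f v - b • v) := by
  have h := LinearMap.congr_fun hf v
  change f (f v) = c • f v - v at h
  rw [map_sub, map_smul, h, ← hc, smul_sub, smul_smul, hab]
  module

/-- Rank-nullity for `f - b`, whose range lies in the `a`-eigenspace. No diagonalizability is
needed, and one of the two eigenspaces has at least half the dimension. -/
theorem finrank_le_add_eigenspace [FiniteDimensional F V] (hf : f * f = c • f - 1)
    (hab : a * b = 1) (hc : a + b = c) :
    Module.finrank F V ≤
      Module.finrank F (f.eigenspace a) + Module.finrank F (f.eigenspace b) := by
  rw [← LinearMap.finrank_range_add_finrank_ker (f - b • 1)]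
  refine add_le_add (Submodule.finrank_mono ?_) (le_of_eq ?_)
  · rintro _ ⟨v, rfl⟩
    exact Module.End.mem_eigenspace_iff.2 (apply_sub_of_quadratic hf hab hc v)
  · rw [Module.End.eigenspace_def]

theorem exists_common_eigenvector [FiniteDimensional F V] {g : Module.End F V} {θ : F}
    (h : Module.finrank F V <
      Module.finrank F (g.eigenspace θ) + Module.finrank F (f.eigenspace a)) :
    ∃ v, v ≠ 0 ∧ g v = θ • v ∧ f v = a • v := by
  have h1 := Submodule.finrank_sup_add_finrank_inf_eq (g.eigenspace θ) (f.eigenspace a)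
  have h2 := Submodule.finrank_le (g.eigenspace θ ⊔ f.eigenspace a)
  have h3 : g.eigenspace θ ⊓ f.eigenspace a ≠ ⊥ := fun h0 => by
    rw [h0, finrank_bot] at h1
    omega
  obtain ⟨v, hv, hv0⟩ := Submodule.exists_mem_ne_zero_of_ne_bot h3
  exact ⟨v, hv0, Module.End.mem_eigenspace_iff.1 hv.1, Module.End.mem_eigenspace_iff.1 hv.2⟩

end Quadratic

namespace IsDAHATuple

variable {q : F} {t : Fin 4 → Module.End F V} {c : Fin 4 → F} {θ θ' a : F}

/-- On `W` the inverse of `t 0` acts as `θ'`, so `(t 0 - θ') (t i w) = symOp t c i w - (θ' * c i) •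
w` lies in `W`; and `W` with its translates spans `V`. -/
theorem sub_smul_mem_of_le_eigenspace (H : IsDAHATuple q t c) (hq : q ≠ 0)
    (hc : θ + θ' = c 0) {W : Submodule F V} (hne : W ≠ ⊥)
    (hS : ∀ i ≠ 0, ∀ w ∈ W, symOp t c i w ∈ W) (hW : ∀ w ∈ W, t 0 w = θ • w) (v : V) :
    t 0 v - θ' • v ∈ W := by
  have h0 : ∀ w ∈ W, t 0 w ∈ W := fun w hw => hW w hw ▸ W.smul_mem θ hw
  have htop := H.translates_invariant hq h0 hS hne
  suffices h : W ⊔ ⨆ i, W.map (t i) ≤ W.comap (t 0 - θ' • 1) by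
    rw [htop] at h
    exact h (Submodule.mem_top (x := v))
  have hsub : ∀ w ∈ W, (t 0 - θ' • 1 : Module.End F V) w ∈ W := fun w hw =>
    W.sub_mem (h0 w hw) (W.smul_mem _ hw)
  refine sup_le hsub (iSup_le fun i => ?_)
  rintro _ ⟨w, hw, rfl⟩
  by_cases hi : i = 0
  · subst hi
    exact hsub _ (h0 w hw)
  · have h1 : symOp t c i w = t 0 (t i w) + qinv (c i) (t i) (qinv (c 0) (t 0) w) := by
      rw [symOp_eq]
      rfl
    rw [qinv_apply (c 0), hW w hw, ← hc, ← sub_smul, add_sub_cancel_left, map_smul,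
      qinv_apply] at h1
    have h2 := W.sub_mem (hS i hi w hw) (W.smul_mem (θ' * c i) hw)
    rw [h1] at h2
    change t 0 (t i w) - θ' • t i w ∈ W
    convert h2 using 1
    module

/-- Dual to the preceding lemma: for `w ∈ W` all translates of `t 0 w - θ • w` stay in `W`, so this
vector vanishes. -/
theorem eq_smul_of_sub_smul_mem (H : IsDAHATuple q t c) (hq : q ≠ 0)
    (hc : θ + θ = c 0) {W : Submodule F V} (hne : W ≠ ⊤)
    (hS : ∀ i ≠ 0, ∀ w ∈ W, symOp t c i w ∈ W) (hW : ∀ v, t 0 v - θ • v ∈ W) :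
    ∀ w ∈ W, t 0 w = θ • w := by
  have h0 : ∀ w ∈ W, t 0 w ∈ W := fun w hw => by
    have := W.add_mem (hW w) (W.smul_mem θ hw)
    rwa [sub_add_cancel] at this
  intro w hw
  rw [← sub_eq_zero]
  refine H.eq_zero_of_translates_mem hq h0 hS hne (hW w) fun i => ?_
  by_cases hi : i = 0
  · subst hi
    exact h0 _ (hW w)
  · have h1 : symOp t c i w = t i (t 0 w) + qinv (c 0) (t 0) (qinv (c i) (t i) w) := rfl
    rw [qinv_apply (c 0), ← hc] at h1
    have h2 := W.sub_mem (W.add_mem (hS i hi w hw) (hW (qinv (c i) (t i) w)))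
      (W.smul_mem (θ * c i) hw)
    rw [h1] at h2
    convert h2 using 1
    simp only [qinv_apply, map_sub, map_smul]
    module

/-- The Askey--Wilson relations with explicit right-hand sides. The point is that `t 0` occurs there
with a coefficient proportional to `c i`. -/
theorem symOp_relations (H : IsDAHATuple q t c) (hq : q ≠ 0) :
    (q • (symOp t c 3 * symOp t c 2) - q⁻¹ • (symOp t c 2 * symOp t c 3) +
        (q ^ 2 - q⁻¹ ^ 2) • symOp t c 1 = (q - q⁻¹) • ((c 3 * c 2) • (1 : Module.End F V) +
          c 1 • (q • qinv (c 0) (t 0) + q⁻¹ • t 0))) ∧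
    (q • (symOp t c 2 * symOp t c 1) - q⁻¹ • (symOp t c 1 * symOp t c 2) +
        (q ^ 2 - q⁻¹ ^ 2) • symOp t c 3 = (q - q⁻¹) • ((c 2 * c 1) • (1 : Module.End F V) +
          c 3 • (q • qinv (c 0) (t 0) + q⁻¹ • t 0))) ∧
    (q • (symOp t c 1 * symOp t c 3) - q⁻¹ • (symOp t c 3 * symOp t c 1) +
        (q ^ 2 - q⁻¹ ^ 2) • symOp t c 2 = (q - q⁻¹) • ((c 1 * c 3) • (1 : Module.End F V) +
          c 2 • (q • qinv (c 0) (t 0) + q⁻¹ • t 0))) := by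
  have hqq := mul_inv_cancel₀ hq
  have e12 : q • (t 1 * t 2) = qinv (c 0) (t 0) * qinv (c 3) (t 3) := by
    rw [H.rel_one_two, smul_smul, hqq, one_smul]
  have e01 : q • (t 0 * t 1) = qinv (c 3) (t 3) * qinv (c 2) (t 2) := by
    rw [H.rel_zero_one, smul_smul, hqq, one_smul]
  have e30 := H.rel_three_zero
  have e23 := H.rel_two_three
  have hsum : t 3 + qinv (c 3) (t 3) = c 3 • 1 := by rw [qinv]; abel
  have h3 : symOp t c 3 = q • (t 1 * t 2) + q⁻¹ • (qinv (c 2) (t 2) * qinv (c 1) (t 1)) := by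
    rw [e12, ← e30, symOp, add_comm]
  have r := three_relations (t 0) (t 1) (t 2) (qinv (c 0) (t 0)) (qinv (c 1) (t 1))
    (qinv (c 2) (t 2)) (c 0) (c 1) (c 2) (c 3) q q⁻¹ hqq rfl rfl rfl (H.quad 0) (H.quad 1)
    (H.quad 2)
    (by rw [mul_assoc (t 0), ← mul_smul_comm, e12, H.mul_inv, ← smul_mul_assoc, ← e30, mul_assoc,
          mul_qinv (H.quad 0), mul_one, add_comm, hsum])
    (by rw [← smul_mul_assoc, e12, mul_assoc (qinv (c 0) (t 0)) (qinv (c 2) (t 2)),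
          ← mul_smul_comm, ← e30, mul_assoc, ← mul_add, ← add_mul, add_comm, hsum,
          smul_mul_assoc, one_mul, mul_smul_comm, qinv_mul (H.quad 0)])
    (by rw [mul_assoc (t 2), ← mul_smul_comm, e01, ← smul_mul_assoc, ← e23, mul_assoc, ← mul_add,
          ← add_mul, add_comm, hsum, smul_mul_assoc, one_mul, mul_smul_comm, mul_qinv (H.quad 2)])
  rw [← h3] at r
  exact r

theorem t_zero_mem_of_ne_zero (H : IsDAHATuple q t c) (hq : IsGeneric q)
    (hne : ∃ i ≠ 0, c i ≠ 0) {W : Submodule F V}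
    (hS : ∀ i ≠ 0, ∀ w ∈ W, symOp t c i w ∈ W) : ∀ w ∈ W, t 0 w ∈ W := by
  intro w hw
  have hq0 := hq.ne_zero
  have hq1 : q - q⁻¹ ≠ 0 := fun h => hq.pow_ne_one 2 two_pos (by
    field_simp at h
    linear_combination h)
  have key : ∀ i j k : Fin 4, i ≠ 0 → j ≠ 0 → k ≠ 0 → ∀ r s : F, s ≠ 0 →
      q • (symOp t c j * symOp t c k) - q⁻¹ • (symOp t c k * symOp t c j) +
        (q ^ 2 - q⁻¹ ^ 2) • symOp t c i = (q - q⁻¹) • (r • (1 : Module.End F V) +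
          s • (q • qinv (c 0) (t 0) + q⁻¹ • t 0)) → t 0 w ∈ W := by
    intro i j k hi hj hk r s hs h
    have h1 := LinearMap.congr_fun h w
    have h2 : (q • (symOp t c j * symOp t c k) - q⁻¹ • (symOp t c k * symOp t c j) +
        (q ^ 2 - q⁻¹ ^ 2) • symOp t c i) w ∈ W :=
      W.add_mem (W.sub_mem (W.smul_mem _ (hS j hj _ (hS k hk w hw)))
        (W.smul_mem _ (hS k hk _ (hS j hj w hw)))) (W.smul_mem _ (hS i hi w hw))
    rw [h1] at h2
    have h3 := W.sub_mem h2 (W.smul_mem ((q - q⁻¹) * (r + s * q * c 0)) hw)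
    -- After `qinv (c 0) (t 0)` is expanded, the coefficient of `t 0` is `-(q - q⁻¹) * s * (q -
    -- q⁻¹)`.
    rw [← Submodule.smul_mem_iff W (neg_ne_zero.2 (mul_ne_zero (mul_ne_zero hq1 hs) hq1))]
    convert h3 using 1
    simp only [LinearMap.smul_apply, LinearMap.add_apply, Module.End.one_apply, qinv_apply]
    module
  obtain ⟨r1, r3, r2⟩ := H.symOp_relations hq0
  obtain ⟨i, hi, hci⟩ := hne
  fin_cases i
  · exact absurd rfl hi
  · exact key 1 3 2 (by decide) (by decide) (by decide) _ _ hci r1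
  · exact key 2 1 3 (by decide) (by decide) (by decide) _ _ hci r2
  · exact key 3 2 1 (by decide) (by decide) (by decide) _ _ hci r3

section FiniteDimensional

variable [FiniteDimensional F V]

/-- If `c i = 0` then `t i * t i = -1`, so `det (t i) ^ 4 = 1`. Were this so for `i = 1, 2, 3`, the
product `q⁻¹ ^ dim V` of all four determinants would be a root of unity. -/
theorem exists_ne_zero_of_isOfFinOrder [Nontrivial V] (H : IsDAHATuple q t c) (hq : IsGeneric q)
    (h0 : IsOfFinOrder (LinearMap.det (t 0))) : ∃ i ≠ 0, c i ≠ 0 := by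
  by_contra! hc
  have hfin : ∀ i ≠ 0, IsOfFinOrder (LinearMap.det (t i)) := fun i hi => by
    have h := congrArg LinearMap.det (H.quad i)
    rw [hc i hi, zero_smul, zero_sub, ← neg_one_smul F (1 : Module.End F V), LinearMap.det_smul,
      map_one, mul_one, map_mul] at h
    refine isOfFinOrder_iff_pow_eq_one.2 ⟨4, by norm_num, ?_⟩
    rw [show 4 = 2 * 2 from rfl, pow_mul, pow_two (LinearMap.det (t i)), h, ← pow_mul, mul_comm,
      pow_mul, neg_one_sq, one_pow]
  refine hq.not_isOfFinOrder (Module.finrank_pos (R := F) (M := V)) ?_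
  rw [← H.det_prod]
  exact ((h0.mul (hfin 1 (by decide))).mul (hfin 2 (by decide))).mul (hfin 3 (by decide))

/-- The case `i = 1` is the chain computation; `braid` brings `t 2` next to `t 0`, and `rotate`
makes `t 3, t 0` the leading pair. -/
theorem det_zero_mul_det (H : IsDAHATuple q t c) (hq : q ≠ 0) {i : Fin 4} (hi : i ≠ 0) {v : V}
    (hv : v ≠ 0) (h0 : t 0 v = θ • v) (h1 : t i v = a • v) (hx : θ * a ≠ 0) :
    LinearMap.det (t 0) * LinearMap.det (t i) =
      if Even (Module.finrank F V) then q⁻¹ ^ Module.finrank F V else θ * a := by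
  fin_cases i
  · exact absurd rfl hi
  · exact H.det_mul_of_common_eigenvector hq h0 h1 hx hv
  · exact H.braid.det_mul_of_common_eigenvector hq h0 h1 hx hv
  · rw [mul_comm, mul_comm θ]
    exact H.rotate.det_mul_of_common_eigenvector hq h1 h0 (mul_comm θ a ▸ hx) hv

theorem det_zero_of_sq_eq_one (H : IsDAHATuple q t c) (hθ : θ * θ = 1) (hc : θ + θ = c 0) :
    LinearMap.det (t 0) = θ ^ Module.finrank F V := by
  rw [det_of_quadratic (apply_sub_of_quadratic (H.quad 0) hθ hc), ← pow_add,
    Nat.add_sub_cancel' (Submodule.finrank_le _)]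

/-- If `V(θ)` were larger it would meet the bigger eigenspace of every `t i`. The resulting values
of `det (t i)` are incompatible with the total determinant `q⁻¹ ^ dim V`, as `q` is not a root of
unity. -/
theorem two_mul_finrank_eigenspace_le [IsAlgClosed F] [Nontrivial V] (H : IsDAHATuple q t c)
    (hq : IsGeneric q) (hθ : θ * θ = 1) (hc : θ + θ = c 0) :
    2 * Module.finrank F ((t 0).eigenspace θ) ≤ Module.finrank F V + 1 := by
  by_contra! hlt
  have hq0 := hq.ne_zero
  have hθ0 : θ ≠ 0 := left_ne_zero_of_mul_eq_one hθ
  have hdet0 := H.det_zero_of_sq_eq_one hθ hc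
  have hpos : 0 < Module.finrank F V := Module.finrank_pos
  have hbig : ∀ i : Fin 4, ∃ a b : F, a * b = 1 ∧ a + b = c i ∧
      Module.finrank F V ≤ 2 * Module.finrank F ((t i).eigenspace a) := fun i => by
    obtain ⟨a, b, hab, hac⟩ := exists_mul_eq_one_add_eq (c i)
    have h := finrank_le_add_eigenspace (H.quad i) hab hac
    by_cases h' : Module.finrank F V ≤ 2 * Module.finrank F ((t i).eigenspace a)
    · exact ⟨a, b, hab, hac, h'⟩
    · exact ⟨b, a, by rw [mul_comm, hab], by rw [add_comm, hac], by omega⟩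
  have hdet : ∀ (i : Fin 4) (a b : F), i ≠ 0 → a * b = 1 →
      Module.finrank F V < Module.finrank F ((t 0).eigenspace θ) +
        Module.finrank F ((t i).eigenspace a) →
      LinearMap.det (t 0) * LinearMap.det (t i) =
        if Even (Module.finrank F V) then q⁻¹ ^ Module.finrank F V else θ * a :=
    fun i a b hi hab h => by
      obtain ⟨v, hv, h0, h1⟩ := exists_common_eigenvector h
      exact H.det_zero_mul_det hq0 hi hv h0 h1 (mul_ne_zero hθ0 (left_ne_zero_of_mul_eq_one hab))
  refine hq.not_isOfFinOrder hpos ?_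
  by_cases hpar : Even (Module.finrank F V)
  · have h1 : LinearMap.det (t 0) = 1 := by
      obtain ⟨m, hm⟩ := hpar.two_dvd
      rw [hdet0, hm, pow_mul, pow_two, hθ, one_pow]
    -- In even dimension three determinants equal `q⁻¹ ^ dim V` while the total is also `q⁻¹ ^ dim
    -- V`, so its square is `1`.
    have h2 : ∀ i ≠ 0, LinearMap.det (t i) = q⁻¹ ^ Module.finrank F V := fun i hi => by
      obtain ⟨a, b, hab, -, hle⟩ := hbig i
      have h := hdet i a b hi hab (by omega)
      rwa [if_pos hpar, h1, one_mul] at h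
    have h3 := H.det_prod
    rw [h1, h2 1 (by decide), h2 2 (by decide), h2 3 (by decide), one_mul] at h3
    exact isOfFinOrder_of_sq_eq_one (mul_right_cancel₀ (pow_ne_zero _ (inv_ne_zero hq0))
      (h3.trans (one_mul _).symm))
  · have hodd := Nat.not_even_iff_odd.1 hpar
    have h1 : LinearMap.det (t 0) = θ := by
      obtain ⟨m, hm⟩ := hodd
      rw [hdet0, hm, pow_succ, pow_mul, pow_two, hθ, one_pow, one_mul]
    have hdet' : ∀ (i : Fin 4) (a b : F), i ≠ 0 → a * b = 1 →
        Module.finrank F V < Module.finrank F ((t 0).eigenspace θ) +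
          Module.finrank F ((t i).eigenspace a) → LinearMap.det (t i) = a :=
      fun i a b hi hab h => by
        have h' := hdet i a b hi hab h
        rw [if_neg hpar, h1] at h'
        exact mul_left_cancel₀ hθ0 h'
    obtain ⟨m, hm⟩ := hodd
    -- In odd dimension `det (t i) = a`. If the `b`-eigenspace also meets `V(θ)`, then `a = b` and
    -- `a * a = 1`. Otherwise that eigenspace is small, so `p = dim ker (t i - a)` is large, and
    -- comparing `a` with `a ^ p * b ^ (dim V - p)` gives a positive power of `a` equal to `1`.
    have h2 : ∀ i ≠ 0, IsOfFinOrder (LinearMap.det (t i)) := fun i hi => by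
      obtain ⟨a, b, hab, hac, hle⟩ := hbig i
      have ha := hdet' i a b hi hab (by omega)
      rw [ha]
      by_cases hb : Module.finrank F V < Module.finrank F ((t 0).eigenspace θ) +
          Module.finrank F ((t i).eigenspace b)
      · have hb' := hdet' i b a hi (by rw [mul_comm, hab]) hb
        rw [← hb', ha] at hab
        exact isOfFinOrder_of_sq_eq_one hab
      · have hsum := finrank_le_add_eigenspace (H.quad i) hab hac
        have hp := Submodule.finrank_le ((t i).eigenspace a)
        have h := det_of_quadratic (apply_sub_of_quadratic (H.quad i) hab hac)
        rw [ha] at h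
        generalize Module.finrank F ((t i).eigenspace a) = p at *
        have h' := congrArg (· * a ^ (Module.finrank F V - p)) h
        simp only [mul_assoc, ← mul_pow] at h'
        rw [mul_comm b, hab, one_pow, mul_one, ← pow_succ'] at h'
        refine isOfFinOrder_iff_pow_eq_one.2
          ⟨p - (Module.finrank F V - p + 1), by omega, ?_⟩
        have ha0 := left_ne_zero_of_mul_eq_one hab
        rw [pow_sub₀ _ ha0 (by omega), h', mul_inv_cancel₀ (pow_ne_zero _ ha0)]
    rw [← H.det_prod]
    exact (((h1 ▸ isOfFinOrder_of_sq_eq_one hθ).mul (h2 1 (by decide))).mul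
      (h2 2 (by decide))).mul (h2 3 (by decide))

/-- Any eigenvector `v` of `t 1` starts a chain, and the chain closes up at `t 2 v` because the next
step, `t 0`, is a scalar. -/
theorem finrank_le_two_of_scalar [IsAlgClosed F] [Nontrivial V] (H : IsDAHATuple q t c)
    (hq : q ≠ 0) (hθ : θ ≠ 0) (h0 : ∀ v, t 0 v = θ • v) : Module.finrank F V ≤ 2 := by
  by_contra! hlt
  obtain ⟨a, ha⟩ := Module.End.exists_eigenvalue (t 1)
  obtain ⟨v, hv⟩ := ha.exists_hasEigenvector
  have h1 : t 1 v = a • v := hv.apply_eq_smul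
  have ha0 : a ≠ 0 := fun h => hv.2 (by
    have := H.inv_mul_apply 1 v
    rwa [h1, h, zero_smul, map_zero, eq_comm] at this)
  refine H.chain_notMem_span hq (h0 v) h1 (mul_ne_zero hθ ha0) hv.2 hlt ?_
  have h2 : chain t v 2 = θ • chain t v 1 := by
    rw [← h0]
    simp [chain, chainStep]
  rw [h2]
  exact Submodule.smul_mem _ _ (Submodule.subset_span ⟨1, by simp, rfl⟩)

end FiniteDimensional

end IsDAHATuple

end Structure

end AskeyWilson

namespace AskeyWilson

/-! ### From irreducible `ℌ_q`-modules to tuples of operators -/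

section Action

variable {F : Type*} [Field F] {q : F} {V : Type*} [AddCommGroup V] [Module F V]
  [Module (DAHA q) V] [IsScalarTower F (DAHA q) V]

variable (q V) in
/-- The action of `t_i` on the `ℌ_q`-module `V`. -/
noncomputable def tEnd (i : Fin 4) : Module.End F V :=
  Algebra.lsmul F F V (DAHA.t q i : DAHA q)

theorem tEnd_apply (i : Fin 4) (v : V) : tEnd q V i v = (DAHA.t q i : DAHA q) • v := rfl

/-- Schur's lemma: an eigenspace of a central element is a nonzero submodule. -/
theorem exists_smul_eq_of_central [IsAlgClosed F] [FiniteDimensional F V]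
    [IsSimpleModule (DAHA q) V] {z : DAHA q} (hz : ∀ x, Commute z x) :
    ∃ r : F, ∀ v : V, z • v = r • v := by
  have := IsSimpleModule.nontrivial (DAHA q) V
  obtain ⟨r, hr⟩ := Module.End.exists_eigenvalue (Algebra.lsmul F F V z)
  obtain ⟨v, hv⟩ := hr.exists_hasEigenvector
  let W : Submodule (DAHA q) V :=
    { carrier := {w | z • w = r • w}
      zero_mem' := by simp
      add_mem' := fun {a b} ha hb => by
        change z • (a + b) = r • (a + b)
        rw [smul_add, smul_add, show z • a = r • a from ha, show z • b = r • b from hb]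
      smul_mem' := fun x w hw => by
        change z • (x • w) = r • (x • w)
        rw [← mul_smul, (hz x).eq, mul_smul, show z • w = r • w from hw, smul_comm] }
  have hW : W = ⊤ := (eq_bot_or_eq_top W).resolve_left fun h =>
    hv.2 ((Submodule.mem_bot (DAHA q)).1 (h ▸ (hv.apply_eq_smul : v ∈ W)))
  exact ⟨r, fun w => (hW ▸ Submodule.mem_top : w ∈ W)⟩

variable (q V) in
theorem exists_isDAHATuple [IsAlgClosed F] [FiniteDimensional F V] [IsSimpleModule (DAHA q) V] :
    ∃ c, IsDAHATuple q (tEnd q V) c ∧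
      ∀ i (v : V), (((DAHA.t q i)⁻¹ : (DAHA q)ˣ) : DAHA q) • v = qinv (c i) (tEnd q V i) v := by
  choose c hc using fun i => exists_smul_eq_of_central (V := V) (DAHA.central q i)
  have hinv : ∀ i (v : V),
      (((DAHA.t q i)⁻¹ : (DAHA q)ˣ) : DAHA q) • v = qinv (c i) (tEnd q V i) v := fun i v => by
    rw [qinv_apply, ← hc, add_smul, tEnd_apply, add_sub_cancel_left]
  refine ⟨c, ⟨fun i => ?_, ?_, fun W hW => ?_⟩, hinv⟩
  · ext v
    have h := hc i ((DAHA.t q i : DAHA q) • v)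
    rw [add_smul, ← mul_smul _ _ v, ← mul_smul _ _ v, Units.inv_mul, one_smul] at h
    change (DAHA.t q i : DAHA q) • (DAHA.t q i : DAHA q) • v =
      c i • ((DAHA.t q i : DAHA q) • v) - v
    rw [← h, add_sub_cancel_right, mul_smul]
  · ext v
    change (DAHA.t q 0 : DAHA q) • (DAHA.t q 1 : DAHA q) • (DAHA.t q 2 : DAHA q) •
      (DAHA.t q 3 : DAHA q) • v = q⁻¹ • v
    rw [← mul_smul, ← mul_smul, ← mul_smul, DAHA.prod, algebraMap_smul]
  · have key : ∀ (x : DAHA q), ∀ w ∈ W, x • w ∈ W := fun x => by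
      induction x using DAHA.induction with
      | hF r => exact fun w hw => by rw [algebraMap_smul]; exact W.smul_mem r hw
      | ht i => exact hW i
      | htInv i => exact fun w hw => by rw [hinv]; exact (qinv_mem_iff hw).2 (hW i w hw)
      | hadd x y hx hy => exact fun w hw => by rw [add_smul]; exact W.add_mem (hx w hw) (hy w hw)
      | hmul x y hx hy => exact fun w hw => by rw [mul_smul]; exact hx _ (hy w hw)
    let W' : Submodule (DAHA q) V := { W with smul_mem' := fun x w hw => key x w hw }
    rcases eq_bot_or_eq_top W' with h | h
    · exact Or.inl (SetLike.coe_injective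
        (congrArg (fun U : Submodule (DAHA q) V => (U : Set V)) h))
    · exact Or.inr (SetLike.coe_injective
        (congrArg (fun U : Submodule (DAHA q) V => (U : Set V)) h))

end Action

/-! ### Transfer between `△_q`-submodules and subspaces -/

section Submodules

variable {F : Type*} [Field F] {q : F} (hq : IsGeneric q) {V : Type*} [AddCommGroup V]
  [Module F V] [Module (DAHA q) V] [IsScalarTower F (DAHA q) V]

/-- The subspace of `V` underlying a `△_q`-submodule. -/
noncomputable def toSubspace (W : Submodule (AW q) (Pullback hq V)) : Submodule F V :=
  (W.restrictScalars F).comap (Pullback.of hq V : V →ₗ[F] Pullback hq V)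

variable {hq} {W W' : Submodule (AW q) (Pullback hq V)}

theorem mem_toSubspace {v : V} : v ∈ toSubspace hq W ↔ Pullback.of hq V v ∈ W := Iff.rfl

theorem toSubspace_le : toSubspace hq W ≤ toSubspace hq W' ↔ W ≤ W' := Iff.rfl

theorem toSubspace_injective :
    Function.Injective (toSubspace hq : Submodule (AW q) (Pullback hq V) → Submodule F V) :=
  fun _ _ h => le_antisymm (toSubspace_le.1 h.le) (toSubspace_le.1 h.ge)

theorem toSubspace_bot : toSubspace hq (⊥ : Submodule (AW q) (Pullback hq V)) = ⊥ := rfl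

theorem toSubspace_top : toSubspace hq (⊤ : Submodule (AW q) (Pullback hq V)) = ⊤ := rfl

theorem toSubspace_inf : toSubspace hq (W ⊓ W') = toSubspace hq W ⊓ toSubspace hq W' := rfl

theorem toSubspace_sup : toSubspace hq (W ⊔ W') = toSubspace hq W ⊔ toSubspace hq W' := by
  ext v
  rw [mem_toSubspace, Submodule.mem_sup, Submodule.mem_sup]
  rfl

theorem toSubspace_eq_bot : toSubspace hq W = ⊥ ↔ W = ⊥ :=
  ⟨fun h => toSubspace_injective (h.trans toSubspace_bot.symm), fun h => h ▸ toSubspace_bot⟩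

theorem toSubspace_eq_top : toSubspace hq W = ⊤ ↔ W = ⊤ :=
  ⟨fun h => toSubspace_injective (h.trans toSubspace_top.symm), fun h => h ▸ toSubspace_top⟩

theorem isCompl_toSubspace (h : IsCompl W W') : IsCompl (toSubspace hq W) (toSubspace hq W') := by
  rw [isCompl_iff, disjoint_iff, codisjoint_iff, ← toSubspace_inf, ← toSubspace_sup,
    h.inf_eq_bot, h.sup_eq_top]
  exact ⟨toSubspace_bot, toSubspace_top⟩

theorem finrank_toSubspace : Module.finrank F (toSubspace hq W) = Module.finrank F W :=
  LinearEquiv.finrank_eq (R := F) (M := toSubspace hq W) (N := W)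
    { toFun := fun x => ⟨Pullback.of hq V x.1, x.2⟩
      invFun := fun x => ⟨(Pullback.of hq V).symm x.1, x.2⟩
      map_add' := fun _ _ => rfl
      map_smul' := fun _ _ => rfl
      left_inv := fun _ => rfl
      right_inv := fun _ => rfl }

theorem toSubspace_t0Eigenspace (θ : F) :
    toSubspace hq (t0Eigenspace hq V θ) = (tEnd q V 0).eigenspace θ := by
  ext v
  rw [Module.End.mem_eigenspace_iff]
  rfl

theorem mem_t0Eigenspace {θ : F} {v : V} :
    Pullback.of hq V v ∈ t0Eigenspace hq V θ ↔ tEnd q V 0 v = θ • v := Iff.rfl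

theorem symOp_mem {c : Fin 4 → F} (hc : ∀ i (v : V),
      (((DAHA.t q i)⁻¹ : (DAHA q)ˣ) : DAHA q) • v = qinv (c i) (tEnd q V i) v)
    (W : Submodule (AW q) (Pullback hq V)) :
    ∀ i ≠ 0, ∀ w ∈ toSubspace hq W, symOp (tEnd q V) c i w ∈ toSubspace hq W := by
  intro i hi w hw
  have e : symOp (tEnd q V) c i w = DAHA.sym q i • w := by
    rw [DAHA.sym, add_smul, mul_inv_rev, Units.val_mul, Units.val_mul, mul_smul, mul_smul, hc, hc]
    rfl
  have key : ∀ g : AWGen, zetaGen q g • w ∈ toSubspace hq W := fun g => by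
    rw [← zeta_gen hq]
    exact W.smul_mem (AW.gen q g) hw
  rw [e]
  fin_cases i
  exacts [absurd rfl hi, key AWGen.A, key AWGen.C, key AWGen.B]

variable (hq V) in
/-- The range of `t₀ - θ` on `V`, as a `△_q`-submodule. -/
noncomputable def t0Range (θ : F) : Submodule (AW q) (Pullback hq V) where
  carrier := {w | ∃ v : V, Pullback.of hq V (tEnd q V 0 v - θ • v) = w}
  zero_mem' := ⟨0, by simp⟩
  add_mem' := by
    rintro _ _ ⟨v, rfl⟩ ⟨w, rfl⟩
    exact ⟨v + w, by rw [← map_add]; congr 1; rw [map_add, smul_add]; abel⟩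
  smul_mem' := by
    rintro x _ ⟨v, rfl⟩
    refine ⟨zeta hq x • v, ?_⟩
    rw [Pullback.smul_of, tEnd_apply, tEnd_apply, smul_sub, ← mul_smul, ← mul_smul,
      (t_zero_commute_zeta hq x).eq, smul_comm θ]

theorem toSubspace_t0Range (θ : F) :
    toSubspace hq (t0Range hq V θ) = LinearMap.range (tEnd q V 0 - θ • 1) := rfl

theorem finrank_t0Range_add [FiniteDimensional F V] (θ : F) :
    Module.finrank F (toSubspace hq (t0Range hq V θ)) +
      Module.finrank F (toSubspace hq (t0Eigenspace hq V θ)) = Module.finrank F V := by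
  rw [toSubspace_t0Range, toSubspace_t0Eigenspace, Module.End.eigenspace_def,
    LinearMap.finrank_range_add_finrank_ker]

theorem t0Range_le_of_le_t0Eigenspace {c : Fin 4 → F} (H : IsDAHATuple q (tEnd q V) c)
    (hc : ∀ i (v : V),
      (((DAHA.t q i)⁻¹ : (DAHA q)ˣ) : DAHA q) • v = qinv (c i) (tEnd q V i) v)
    {θ θ' : F} (hθ : θ + θ' = c 0) (hW : W ≠ ⊥) (hle : W ≤ t0Eigenspace hq V θ) :
    t0Range hq V θ' ≤ W := by
  rintro _ ⟨v, rfl⟩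
  exact H.sub_smul_mem_of_le_eigenspace hq.ne_zero hθ (mt toSubspace_eq_bot.1 hW)
    (symOp_mem hc W) (fun w hw => hle hw) v

end Submodules

/-! ### Position of a `△_q`-submodule relative to the eigenspaces of `t 0` -/

section Main

variable {F : Type*} [Field F] {q : F} {hq : IsGeneric q} {V : Type*} [AddCommGroup V]
  [Module F V] [Module (DAHA q) V] [IsScalarTower F (DAHA q) V] {c : Fin 4 → F} {θ θ' : F}
  {W : Submodule (AW q) (Pullback hq V)}

theorem t0Range_le_t0Eigenspace (H : IsDAHATuple q (tEnd q V) c) (hθ : θ * θ' = 1)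
    (hc : θ + θ' = c 0) : t0Range hq V θ' ≤ t0Eigenspace hq V θ := by
  rintro _ ⟨v, rfl⟩
  exact apply_sub_of_quadratic (H.quad 0) hθ hc v

theorem t0Eigenspace_le_t0Range (hne : θ ≠ θ') : t0Eigenspace hq V θ ≤ t0Range hq V θ' := by
  intro w hw
  obtain ⟨v, rfl⟩ := (Pullback.of hq V).surjective w
  refine ⟨(θ - θ')⁻¹ • v, ?_⟩
  rw [map_smul, mem_t0Eigenspace.1 hw, smul_comm θ', ← smul_sub, ← sub_smul,
    inv_smul_smul₀ (sub_ne_zero.2 hne)]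

theorem isCompl_t0Eigenspace (H : IsDAHATuple q (tEnd q V) c) (hθ : θ * θ' = 1)
    (hc : θ + θ' = c 0) (hne : θ ≠ θ') :
    IsCompl (t0Eigenspace hq V θ) (t0Eigenspace hq V θ') := by
  rw [isCompl_iff, disjoint_iff, codisjoint_iff]
  constructor
  · rw [eq_bot_iff]
    rintro w ⟨h1, h2⟩
    obtain ⟨v, rfl⟩ := (Pullback.of hq V).surjective w
    have h : (θ - θ') • v = 0 := by
      rw [sub_smul, ← mem_t0Eigenspace.1 h1, ← mem_t0Eigenspace.1 h2, sub_self]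
    rw [(smul_eq_zero.1 h).resolve_left (sub_ne_zero.2 hne), map_zero]
    exact Submodule.zero_mem _
  · rw [eq_top_iff]
    intro w _
    obtain ⟨v, rfl⟩ := (Pullback.of hq V).surjective w
    -- The decomposition is `v = (θ - θ')⁻¹ ((t 0 - θ') v - (t 0 - θ) v)`.
    have h1 := t0Range_le_t0Eigenspace (hq := hq) H hθ hc ⟨(θ - θ')⁻¹ • v, rfl⟩
    have h2 := t0Range_le_t0Eigenspace (hq := hq) H (mul_comm θ θ' ▸ hθ) (add_comm θ θ' ▸ hc)
      ⟨-((θ - θ')⁻¹ • v), rfl⟩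
    have h := Submodule.add_mem_sup h1 h2
    rw [← map_add] at h
    convert h using 2
    rw [map_neg]
    have := inv_smul_smul₀ (sub_ne_zero.2 hne) v
    rw [smul_comm] at this
    refine this.symm.trans ?_
    module

theorem eq_or_eq_of_hasEigenvalue (H : IsDAHATuple q (tEnd q V) c) (hθ : θ * θ' = 1)
    (hc : θ + θ' = c 0) {μ : F} (hμ : (t0End q V).HasEigenvalue μ) : μ = θ ∨ μ = θ' := by
  obtain ⟨v, hv⟩ := hμ.exists_hasEigenvector
  have h1 : tEnd q V 0 v = μ • v := hv.apply_eq_smul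
  have h := apply_sub_of_quadratic (H.quad 0) hθ hc v
  rw [h1, ← sub_smul, map_smul, h1, ← sub_eq_zero, smul_smul, smul_smul, ← sub_smul] at h
  have h2 := (smul_eq_zero.1 h).resolve_right hv.2
  have h3 : (μ - θ) * (μ - θ') = 0 := by linear_combination h2
  exact (mul_eq_zero.1 h3).imp sub_eq_zero.1 sub_eq_zero.1

theorem isDiagonalizable_of_forall (h : ∀ v, tEnd q V 0 v = θ • v) :
    IsDiagonalizable (t0End q V) :=
  eq_top_iff.2 fun v _ => Submodule.mem_iSup_of_mem θ (Module.End.mem_eigenspace_iff.2 (h v))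

theorem isDiagonalizable_of_ne (hq : IsGeneric q) (H : IsDAHATuple q (tEnd q V) c)
    (hθ : θ * θ' = 1) (hc : θ + θ' = c 0) (hne : θ ≠ θ') : IsDiagonalizable (t0End q V) := by
  have h := (isCompl_toSubspace (isCompl_t0Eigenspace (hq := hq) H hθ hc hne)).sup_eq_top
  rw [toSubspace_t0Eigenspace, toSubspace_t0Eigenspace] at h
  exact top_le_iff.1 (h ▸ sup_le (le_iSup (t0End q V).eigenspace θ)
    (le_iSup (t0End q V).eigenspace θ'))

theorem t0_mem_of_isOfFinOrder [FiniteDimensional F V] [Nontrivial V]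
    (H : IsDAHATuple q (tEnd q V) c)
    (hinv : ∀ i (v : V),
      (((DAHA.t q i)⁻¹ : (DAHA q)ˣ) : DAHA q) • v = qinv (c i) (tEnd q V i) v)
    (hdet : IsOfFinOrder (LinearMap.det (tEnd q V 0))) (W : Submodule (AW q) (Pullback hq V)) :
    ∀ w ∈ toSubspace hq W, tEnd q V 0 w ∈ toSubspace hq W :=
  H.t_zero_mem_of_ne_zero hq (H.exists_ne_zero_of_isOfFinOrder hq hdet) (symOp_mem hinv W)

/-- As `det (t 0)` is a power of `θ = ±1`, `W` is stable under `t 0`. A vector of `W` outside `V(θ)`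
is sent by `t 0 - θ` to a nonzero vector of `W ⊓ V(θ)`, so `W` contains the whole range of `t 0 -
θ`; if `W` were proper, it would then lie in `V(θ)`. -/
theorem le_t0Eigenspace_or_eq_top [FiniteDimensional F V] [Nontrivial V]
    (H : IsDAHATuple q (tEnd q V) c)
    (hinv : ∀ i (v : V),
      (((DAHA.t q i)⁻¹ : (DAHA q)ˣ) : DAHA q) • v = qinv (c i) (tEnd q V i) v)
    (hθ : θ * θ = 1) (hc : θ + θ = c 0) (W : Submodule (AW q) (Pullback hq V)) :
    W ≤ t0Eigenspace hq V θ ∨ W = ⊤ := by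
  by_contra! hW
  obtain ⟨hle, htop⟩ := hW
  have h0 := t0_mem_of_isOfFinOrder H hinv
    (H.det_zero_of_sq_eq_one hθ hc ▸ (isOfFinOrder_of_sq_eq_one hθ).pow) W
  obtain ⟨w, hw, hwK⟩ := SetLike.not_le_iff_exists.1 hle
  obtain ⟨v, rfl⟩ := (Pullback.of hq V).surjective w
  have hne : W ⊓ t0Eigenspace hq V θ ≠ ⊥ := fun h => by
    have hmem : Pullback.of hq V (tEnd q V 0 v - θ • v) ∈ W ⊓ t0Eigenspace hq V θ :=
      ⟨(toSubspace hq W).sub_mem (h0 v hw) ((toSubspace hq W).smul_mem θ hw),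
        t0Range_le_t0Eigenspace H hθ hc ⟨v, rfl⟩⟩
    rw [h, Submodule.mem_bot, LinearEquiv.map_eq_zero_iff, sub_eq_zero] at hmem
    exact hwK hmem
  have hr := (t0Range_le_of_le_t0Eigenspace H hinv hc hne inf_le_right).trans inf_le_left
  exact hle fun w hw => H.eq_smul_of_sub_smul_mem hq.ne_zero hc (mt toSubspace_eq_top.1 htop)
    (symOp_mem hinv W) (fun v => hr ⟨v, rfl⟩) w hw

/-- For `θ ≠ θ'` the range of `t 0 - θ'` contains `V(θ)`, and every nonzero submodule of `V(θ)`
contains that range. In particular `V(θ)` has no nonzero proper submodule. -/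
theorem t0Eigenspace_le_of_inf_ne_bot (H : IsDAHATuple q (tEnd q V) c)
    (hinv : ∀ i (v : V),
      (((DAHA.t q i)⁻¹ : (DAHA q)ˣ) : DAHA q) • v = qinv (c i) (tEnd q V i) v)
    (hc : θ + θ' = c 0) (hne : θ ≠ θ') (hW : W ⊓ t0Eigenspace hq V θ ≠ ⊥) :
    t0Eigenspace hq V θ ≤ W :=
  (t0Eigenspace_le_t0Range hne).trans
    ((t0Range_le_of_le_t0Eigenspace H hinv hc hW inf_le_right).trans inf_le_left)

/-- A `△_q`-submodule that contains one of the two eigenspaces of `t₀`. -/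
theorem eq_or_eq_top_of_t0Eigenspace_le (H : IsDAHATuple q (tEnd q V) c)
    (hinv : ∀ i (v : V),
      (((DAHA.t q i)⁻¹ : (DAHA q)ˣ) : DAHA q) • v = qinv (c i) (tEnd q V i) v)
    (hθ : θ * θ' = 1) (hc : θ + θ' = c 0) (hne : θ ≠ θ') (hW : t0Eigenspace hq V θ ≤ W) :
    W = t0Eigenspace hq V θ ∨ W = ⊤ := by
  have hcompl := isCompl_t0Eigenspace (hq := hq) H hθ hc hne
  by_cases h : W ⊓ t0Eigenspace hq V θ' = ⊥
  · left
    rw [← sup_bot_eq (t0Eigenspace hq V θ), ← h, inf_comm, ← sup_inf_assoc_of_le _ hW,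
      hcompl.sup_eq_top, top_inf_eq]
  · right
    have h' := t0Eigenspace_le_of_inf_ne_bot H hinv (add_comm θ θ' ▸ hc) hne.symm h
    rw [eq_top_iff, ← hcompl.sup_eq_top]
    exact sup_le hW h'

theorem submodule_classification_of_ne [FiniteDimensional F V] [Nontrivial V]
    (H : IsDAHATuple q (tEnd q V) c)
    (hinv : ∀ i (v : V),
      (((DAHA.t q i)⁻¹ : (DAHA q)ˣ) : DAHA q) • v = qinv (c i) (tEnd q V i) v)
    (hθ : θ * θ' = 1) (hc : θ + θ' = c 0) (hne : θ ≠ θ')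
    (W : Submodule (AW q) (Pullback hq V)) :
    W = ⊥ ∨ W = t0Eigenspace hq V θ ∨ W = t0Eigenspace hq V θ' ∨ W = ⊤ := by
  have hθ' : θ' * θ = 1 := mul_comm θ θ' ▸ hθ
  have hc' : θ' + θ = c 0 := add_comm θ θ' ▸ hc
  by_cases h1 : W ⊓ t0Eigenspace hq V θ = ⊥
  swap
  · rcases eq_or_eq_top_of_t0Eigenspace_le H hinv hθ hc hne
      (t0Eigenspace_le_of_inf_ne_bot H hinv hc hne h1) with h | h <;> simp [h]
  by_cases h2 : W ⊓ t0Eigenspace hq V θ' = ⊥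
  swap
  · rcases eq_or_eq_top_of_t0Eigenspace_le H hinv hθ' hc' hne.symm
      (t0Eigenspace_le_of_inf_ne_bot H hinv hc' hne.symm h2) with h | h <;> simp [h]
  left
  by_contra hbot
  -- A nonzero `W` meeting both eigenspaces trivially is a complement of each, so both have
  -- dimension `dim V / 2` and `det (t 0) = (θ * θ') ^ (dim V / 2) = 1`. This makes `W` stable under
  -- `t 0`, hence the sum of its intersections with the eigenspaces, which is zero.
  have compl : ∀ μ μ' : F, μ * μ' = 1 → μ + μ' = c 0 → μ ≠ μ' →
      W ⊓ t0Eigenspace hq V μ = ⊥ → IsCompl W (t0Eigenspace hq V μ) := by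
    intro μ μ' hμ hμc hμne h
    refine isCompl_iff.2 ⟨disjoint_iff.2 h, codisjoint_iff.2 ?_⟩
    refine (eq_or_eq_top_of_t0Eigenspace_le H hinv hμ hμc hμne le_sup_right).resolve_left
      fun hsup => hbot ?_
    rw [← h, eq_comm, inf_eq_left, ← hsup]
    exact le_sup_left
  have d1 := Submodule.finrank_add_eq_of_isCompl
    (isCompl_toSubspace (compl θ θ' hθ hc hne h1))
  have d2 := Submodule.finrank_add_eq_of_isCompl
    (isCompl_toSubspace (compl θ' θ hθ' hc' hne.symm h2))
  have d3 := Submodule.finrank_add_eq_of_isCompl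
    (isCompl_toSubspace (isCompl_t0Eigenspace (hq := hq) H hθ hc hne))
  have hdet : LinearMap.det (tEnd q V 0) = 1 := by
    rw [det_of_quadratic (apply_sub_of_quadratic (H.quad 0) hθ hc),
      ← toSubspace_t0Eigenspace (hq := hq),
      show Module.finrank F V - Module.finrank F (toSubspace hq (t0Eigenspace hq V θ)) =
        Module.finrank F (toSubspace hq (t0Eigenspace hq V θ)) by omega, ← mul_pow, hθ, one_pow]
  have h0 := t0_mem_of_isOfFinOrder H hinv (hdet ▸ IsOfFinOrder.one) W
  refine hbot (eq_bot_iff.2 fun w hw => ?_)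
  obtain ⟨v, rfl⟩ := (Pullback.of hq V).surjective w
  have hmem : Pullback.of hq V (tEnd q V 0 v - θ' • v) ∈ W ⊓ t0Eigenspace hq V θ :=
    ⟨(toSubspace hq W).sub_mem (h0 v hw) ((toSubspace hq W).smul_mem θ' hw),
      t0Range_le_t0Eigenspace H hθ hc ⟨v, rfl⟩⟩
  rw [h1, Submodule.mem_bot, LinearEquiv.map_eq_zero_iff, sub_eq_zero] at hmem
  rw [← h2]
  exact ⟨hw, hmem⟩

end Main

end AskeyWilson

namespace AskeyWilson

/-! ### The scalar and the non-diagonalizable cases -/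

section Conclusions

variable {F : Type*} [Field F] {q : F} {hq : IsGeneric q} {V : Type*} [AddCommGroup V]
  [Module F V] [Module (DAHA q) V] [IsScalarTower F (DAHA q) V] {c : Fin 4 → F} {θ : F}

theorem eq_of_le_of_finrank_toSubspace_le [FiniteDimensional F V]
    {W W' : Submodule (AW q) (Pullback hq V)} (h : W ≤ W')
    (hr : Module.finrank F (toSubspace hq W') ≤ Module.finrank F (toSubspace hq W)) : W = W' :=
  toSubspace_injective (Submodule.eq_of_le_of_finrank_le (toSubspace_le.2 h) hr)

theorem isSimpleModule_of_forall_eq [FiniteDimensional F V] [IsAlgClosed F] [Nontrivial V]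
    (H : IsDAHATuple q (tEnd q V) c)
    (hinv : ∀ i (v : V),
      (((DAHA.t q i)⁻¹ : (DAHA q)ˣ) : DAHA q) • v = qinv (c i) (tEnd q V i) v)
    (h : ∀ v, tEnd q V 0 v = θ • v) :
    IsSimpleModule (AW q) (Pullback hq V) ∧ Module.finrank F V ≤ 2 := by
  obtain ⟨v, hv⟩ := exists_ne (0 : V)
  have hquad : θ * θ = c 0 * θ - 1 := by
    have h1 := LinearMap.congr_fun (H.quad 0) v
    change tEnd q V 0 (tEnd q V 0 v) = c 0 • tEnd q V 0 v - v at h1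
    rw [h, h, smul_smul, smul_smul, ← sub_eq_zero] at h1
    have h2 : (θ * θ - (c 0 * θ - 1)) • v = 0 := by rw [← h1]; module
    exact sub_eq_zero.1 ((smul_eq_zero.1 h2).resolve_right hv)
  have hθ : θ * (c 0 - θ) = 1 := by linear_combination -hquad
  have hθ0 : θ ≠ 0 := left_ne_zero_of_mul_eq_one hθ
  have hc : θ + (c 0 - θ) = c 0 := by ring
  refine ⟨?_, H.finrank_le_two_of_scalar hq.ne_zero hθ0 h⟩
  have hKtop : t0Eigenspace hq V θ = ⊤ := eq_top_iff.2 fun w _ => h w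
  have : Nontrivial (Pullback hq V) := inferInstanceAs (Nontrivial V)
  refine (isSimpleModule_iff _ _).2 ⟨fun W => or_iff_not_imp_left.2 fun hW => ?_⟩
  -- The other root of the quadratic is `c 0 - θ`. For a double root, `V(θ) = V` and the bound on
  -- `dim V(θ)` leave only `dim V = 1`.
  by_cases hne : θ = c 0 - θ
  · have hle := H.two_mul_finrank_eigenspace_le hq (θ := θ) (by rwa [← hne] at hθ)
      (by rwa [← hne] at hc)
    rw [← toSubspace_t0Eigenspace (hq := hq), hKtop, toSubspace_top, finrank_top] at hle
    have hpos := Submodule.one_le_finrank_iff.2 (mt toSubspace_eq_bot.1 hW)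
    refine eq_of_le_of_finrank_toSubspace_le le_top ?_
    rw [toSubspace_top, finrank_top]
    omega
  · rw [eq_top_iff, ← hKtop]
    refine t0Eigenspace_le_of_inf_ne_bot H hinv hc hne ?_
    rwa [hKtop, inf_top_eq]

/-- Let `I` be the range of `t 0 - θ` and `K = V(θ)`. Then `I ≤ K`, `dim I + dim K = dim V` and `2
dim K ≤ dim V + 1`, so `dim K - dim I` is `0` or `1`, with the parity of `dim V`. Nonzero submodules
of `K` contain `I`, and all submodules not inside `K` are `V`; thus `V'` is `I`. -/
theorem submodule_classification_of_not_isDiagonalizable [FiniteDimensional F V] [IsAlgClosed F]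
    [Nontrivial V] (H : IsDAHATuple q (tEnd q V) c)
    (hinv : ∀ i (v : V),
      (((DAHA.t q i)⁻¹ : (DAHA q)ˣ) : DAHA q) • v = qinv (c i) (tEnd q V i) v)
    (hθ : θ * θ = 1) (hc : θ + θ = c 0) (hdiag : ¬ IsDiagonalizable (t0End q V)) :
    (Even (Module.finrank F V) →
      ⊥ < t0Eigenspace hq V θ ∧ t0Eigenspace hq V θ < ⊤ ∧
      ∀ W : Submodule (AW q) (Pullback hq V),
        W = ⊥ ∨ W = t0Eigenspace hq V θ ∨ W = ⊤) ∧
    (Odd (Module.finrank F V) →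
      ∃ V' : Submodule (AW q) (Pullback hq V),
        (∀ W : Submodule (AW q) (Pullback hq V),
          (W ≤ t0Eigenspace hq V θ ∧ IsSimpleModule (AW q) W ∧
            Module.finrank F W + 1 = Module.finrank F (t0Eigenspace hq V θ)) ↔ W = V') ∧
        ⊥ < V' ∧ V' < t0Eigenspace hq V θ ∧ t0Eigenspace hq V θ < ⊤ ∧
        ∀ W : Submodule (AW q) (Pullback hq V),
          W = ⊥ ∨ W = V' ∨ W = t0Eigenspace hq V θ ∨ W = ⊤) := by
  set K := t0Eigenspace hq V θ with hK
  set I := t0Range hq V θ with hI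
  have hIK : I ≤ K := t0Range_le_t0Eigenspace H hθ hc
  have hsum := finrank_t0Range_add (hq := hq) (V := V) θ
  rw [← hK, ← hI] at hsum
  have hdim := H.two_mul_finrank_eigenspace_le hq hθ hc
  rw [← toSubspace_t0Eigenspace (hq := hq), ← hK] at hdim
  have hmono := Submodule.finrank_mono (toSubspace_le.2 hIK)
  have hmin : ∀ W : Submodule (AW q) (Pullback hq V), W ≠ ⊥ → W ≤ K → I ≤ W :=
    fun W hW hle => t0Range_le_of_le_t0Eigenspace H hinv hc hW hle
  have hmax := le_t0Eigenspace_or_eq_top (hq := hq) H hinv hθ hc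
  rw [← hK] at hmax
  have hKtop : K < ⊤ := lt_top_iff_ne_top.2 fun h => hdiag
    (isDiagonalizable_of_forall fun v => (h ▸ Submodule.mem_top : Pullback.of hq V v ∈ K))
  have hIbot : ⊥ < I := bot_lt_iff_ne_bot.2 fun h => hKtop.ne (by
    refine eq_of_le_of_finrank_toSubspace_le le_top ?_
    rw [h, toSubspace_bot, finrank_bot] at hsum
    rw [toSubspace_top, finrank_top]
    omega)
  constructor
  · rintro ⟨m, hm⟩
    have hKI : I = K := eq_of_le_of_finrank_toSubspace_le hIK (by omega)
    refine ⟨hIbot.trans_le hIK, hKtop, fun W => ?_⟩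
    by_cases hW : W = ⊥
    · exact Or.inl hW
    · exact Or.inr ((hmax W).imp_left fun h => le_antisymm h (hKI ▸ hmin W hW h))
  · rintro ⟨m, hm⟩
    have hcodim : Module.finrank F (toSubspace hq I) + 1 = Module.finrank F (toSubspace hq K) := by
      omega
    refine ⟨I, fun W => ⟨fun ⟨hle, hsimple, hr⟩ => ?_, ?_⟩, hIbot, ?_, hKtop, fun W => ?_⟩
    · have hW : W ≠ ⊥ := (isSimpleModule_iff_isAtom.1 hsimple).1
      rw [← finrank_toSubspace, ← finrank_toSubspace] at hr
      exact (eq_of_le_of_finrank_toSubspace_le (hmin W hW hle) (by omega)).symm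
    · rintro rfl
      refine ⟨hIK, isSimpleModule_iff_isAtom.2 ⟨hIbot.ne', fun U hU => ?_⟩, ?_⟩
      · by_contra hne
        exact hU.not_ge (hmin U hne (hU.le.trans hIK))
      · rw [← finrank_toSubspace, ← finrank_toSubspace, hcodim]
    · refine lt_of_le_of_ne hIK fun h => ?_
      rw [h] at hcodim
      omega
    · by_cases hW : W = ⊥
      · exact Or.inl hW
      refine Or.inr ?_
      rcases hmax W with h | h
      · have hIW := hmin W hW h
        have h1 := Submodule.finrank_mono (toSubspace_le.2 hIW)
        have h2 := Submodule.finrank_mono (toSubspace_le.2 h)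
        by_cases h3 : Module.finrank F (toSubspace hq W) ≤ Module.finrank F (toSubspace hq I)
        · exact Or.inl (eq_of_le_of_finrank_toSubspace_le hIW h3).symm
        · exact Or.inr (Or.inl (eq_of_le_of_finrank_toSubspace_le h (by omega)))
      · exact Or.inr (Or.inr h)

theorem bot_lt_t0Eigenspace (h : (t0End q V).HasEigenvalue θ) : ⊥ < t0Eigenspace hq V θ := by
  rw [bot_lt_iff_ne_bot, ← toSubspace_eq_bot.ne, toSubspace_t0Eigenspace]
  exact h

end Conclusions

end AskeyWilson

open AskeyWilson in
theorem theorem5p1 {F : Type*} [Field F] [IsAlgClosed F] {q : F} (hq : IsGeneric q)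
    (V : Type*) [AddCommGroup V] [Module F V] [Module (DAHA q) V] [IsScalarTower F (DAHA q) V]
    [FiniteDimensional F V] [IsSimpleModule (DAHA q) V] :
    (¬ IsDiagonalizable (t0End q V) →
      ∃ θ : F, (θ = 1 ∨ θ = -1) ∧
        (∀ μ : F, (t0End q V).HasEigenvalue μ ↔ μ = θ) ∧
        (Even (Module.finrank F V) →
          ⊥ < t0Eigenspace hq V θ ∧ t0Eigenspace hq V θ < ⊤ ∧
          ∀ W : Submodule (AW q) (Pullback hq V),
            W = ⊥ ∨ W = t0Eigenspace hq V θ ∨ W = ⊤) ∧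
        (Odd (Module.finrank F V) →
          ∃ V' : Submodule (AW q) (Pullback hq V),
            (∀ W : Submodule (AW q) (Pullback hq V),
              (W ≤ t0Eigenspace hq V θ ∧ IsSimpleModule (AW q) W ∧
                Module.finrank F W + 1 = Module.finrank F (t0Eigenspace hq V θ)) ↔ W = V') ∧
            ⊥ < V' ∧ V' < t0Eigenspace hq V θ ∧ t0Eigenspace hq V θ < ⊤ ∧
            ∀ W : Submodule (AW q) (Pullback hq V),
              W = ⊥ ∨ W = V' ∨ W = t0Eigenspace hq V θ ∨ W = ⊤)) ∧
    (IsDiagonalizable (t0End q V) →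
      {μ : F | (t0End q V).HasEigenvalue μ}.encard ≤ 2 ∧
      ({μ : F | (t0End q V).HasEigenvalue μ}.encard = 1 →
        IsSimpleModule (AW q) (Pullback hq V) ∧ Module.finrank F V ≤ 2) ∧
      ({μ : F | (t0End q V).HasEigenvalue μ}.encard = 2 →
        ∃ θ : F, θ ≠ 0 ∧ θ ≠ 1 ∧ θ ≠ -1 ∧
          {μ : F | (t0End q V).HasEigenvalue μ} = {θ, θ⁻¹} ∧
          ⊥ < t0Eigenspace hq V θ ∧ t0Eigenspace hq V θ < ⊤ ∧
          ⊥ < t0Eigenspace hq V θ⁻¹ ∧ t0Eigenspace hq V θ⁻¹ < ⊤ ∧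
          IsCompl (t0Eigenspace hq V θ) (t0Eigenspace hq V θ⁻¹) ∧
          ∀ W : Submodule (AW q) (Pullback hq V),
            W = ⊥ ∨ W = t0Eigenspace hq V θ ∨ W = t0Eigenspace hq V θ⁻¹ ∨ W = ⊤)) := by
  have : Nontrivial V := IsSimpleModule.nontrivial (DAHA q) V
  obtain ⟨c, H, hinv⟩ := exists_isDAHATuple q V
  obtain ⟨θ, θ', hθ, hc⟩ := exists_mul_eq_one_add_eq (c 0)
  have hsub : {μ : F | (t0End q V).HasEigenvalue μ} ⊆ {θ, θ'} := fun μ hμ =>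
    eq_or_eq_of_hasEigenvalue H hθ hc hμ
  have hpair : ({θ, θ'} : Set F).encard ≤ 2 := by
    rcases eq_or_ne θ θ' with h | h
    · rw [h, Set.pair_eq_singleton, Set.encard_singleton]
      exact one_le_two
    · exact (Set.encard_pair h).le
  constructor
  · intro hdiag
    -- Distinct roots would make `t 0` diagonalizable; a double root has square `1`.
    obtain rfl : θ = θ' := by
      by_contra hne
      exact hdiag (isDiagonalizable_of_ne hq H hθ hc hne)
    refine ⟨θ, mul_self_eq_one_iff.1 hθ, fun μ => ⟨fun hμ => by simpa using hsub hμ, ?_⟩,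
      submodule_classification_of_not_isDiagonalizable H hinv hθ hc hdiag⟩
    rintro rfl
    obtain ⟨ν, hν⟩ := Module.End.exists_eigenvalue (t0End q V)
    have hνμ : ν = μ := by simpa using hsub hν
    exact hνμ ▸ hν
  · intro hdiag
    refine ⟨(Set.encard_le_encard hsub).trans hpair, fun hcard => ?_,
      fun hcard => ?_⟩
    · obtain ⟨μ, hμ⟩ := Set.encard_eq_one.1 hcard
      refine isSimpleModule_of_forall_eq (θ := μ) H hinv fun v => ?_
      -- A diagonalizable operator with a single eigenvalue is a scalar.
      have htop : (t0End q V).eigenspace μ = ⊤ := by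
        rw [eq_top_iff, ← hdiag]
        refine iSup_le fun ν => ?_
        by_cases hν : (t0End q V).HasEigenvalue ν
        · have : ν ∈ ({μ} : Set F) := hμ ▸ hν
          rw [Set.mem_singleton_iff.1 this]
        · rw [Module.End.hasEigenvalue_iff, not_not] at hν
          rw [hν]
          exact bot_le
      exact Module.End.mem_eigenspace_iff.1 (htop ▸ Submodule.mem_top)
    · have hne : θ ≠ θ' := by
        rintro rfl
        have h := Set.encard_le_encard hsub
        rw [hcard, Set.pair_eq_singleton, Set.encard_singleton] at h
        exact absurd h (by decide)
      have heq : {μ : F | (t0End q V).HasEigenvalue μ} = {θ, θ'} :=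
        ((Set.toFinite {θ, θ'}).subset hsub).eq_of_subset_of_encard_le hsub
          (hpair.trans hcard.ge)
      obtain rfl : θ' = θ⁻¹ := eq_inv_of_mul_eq_one_right hθ
      have h1 : ⊥ < t0Eigenspace hq V θ :=
        bot_lt_t0Eigenspace (show θ ∈ {μ : F | (t0End q V).HasEigenvalue μ} by simp [heq])
      have h2 : ⊥ < t0Eigenspace hq V θ⁻¹ :=
        bot_lt_t0Eigenspace (show θ⁻¹ ∈ {μ : F | (t0End q V).HasEigenvalue μ} by simp [heq])
      have hcompl := isCompl_t0Eigenspace (hq := hq) H hθ hc hne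
      refine ⟨θ, left_ne_zero_of_mul_eq_one hθ, ?_, ?_, heq, h1, ?_, h2, ?_, hcompl,
        submodule_classification_of_ne H hinv hθ hc hne⟩
      · rintro rfl
        exact hne (by simp)
      · rintro rfl
        exact hne (by simp)
      · exact lt_top_iff_ne_top.2 fun h => h2.ne' (by simpa [h] using hcompl.inf_eq_bot)
      · exact lt_top_iff_ne_top.2 fun h => h1.ne' (by simpa [h] using hcompl.inf_eq_bot)
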